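/- **Theorem 3.1.** Let $K$ be a compact connected Lie group of dimension $n$ with Lie algebra $\mathfrak K$, let $(\cdot,\cdot)$ be an $\mathrm{Ad}$-invariant inner product on $\mathfrak K$ and $X_1,\dots,X_n$ an orthonormal basis. Let $K_{\mathbb C}$ be the complexification of $K$; it is realized, through a smooth faithful unitary representation $K\to U(N)$ (one exists for every compact $K$), as $K_{\mathbb C}=\{xe^{iY}: x\in K,\ Y\in\mathfrak K\}\subset GL(N,\mathbb C)$. Identify $T^*K$ with $K\times\mathfrak K$ by left translations and the inner product. Let $\omega=-d\theta$, with $\theta_{(x,Y)}=\sum_i y^i w^i$, be its canonical symplectic form, where $w^i$ are the left-invariant one-forms dual to $X_i$ and $Y=\sum_i y^iX_i$; let $\epsilon=\omega^n/n!$, with Liouville measure $dx\,dY$, where $dx$ is a Haar measure on $K$. (One may normalize the inner product so that its Riemannian measure is the normalized Haar measure; the result does not depend on this.) For $s>0$ let $\psi_s:T^*K\to K_{\mathbb C}$, $\psi_s(x,Y)=xe^{isY}$, and let $J_s$ be the complex structure on $T^*K$ pulled back along $\psi_s$. Let $\tilde\eta_s^j$ ($1\le j\le n$) be the $J_s$-holomorphic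 one-forms obtained by pulling back along $\psi_s$ the left-invariant holomorphic one-forms of $K_{\mathbb C}$ dual to $X_1,\dots,X_n$, let $\Omega_s=\tilde\eta^1_s\wedge\dots\wedge\tilde\eta^n_s$, $b=(2i)^n(-1)^{n(n-1)/2}$, and let $|\Omega_s|\ge0$ be defined by $\overline{\Omega_s}\wedge\Omega_s=|\Omega_s|^2\,b\,\epsilon$. * The prequantum Hilbert space $\mathcal H^{prQ}_s$ consists of the sections $f\sqrt{\Omega_s}$ with $\int_{T^*K}|f|^2|\Omega_s|\,\epsilon<\infty$, and $\langle f\sqrt{\Omega_s},f'\sqrt{\Omega_s}\rangle^{prQ}=\int_{T^*K}\bar f f'\,|\Omega_s|\,\epsilon$. The bundle $\mathcal H^{prQ}\to\mathbb R_+$ has the smooth structure and the connection $\delta^{prQ}$ that the global trivialization $(g,s)\mapsto \frac{g}{\sqrt{|\Omega_s|}}\sqrt{\Omega_s}$, $g\in L^2(T^*K,\epsilon)$, carries over from the trivial bundle with the trivial connection. * Fix $\hbar_0>0$. The quantum Hilbert space $\mathcal H^{Q}_s\subset\mathcal H^{prQ}_s$ is the closed subspace of the sections $Fe^{-s|Y|^2/(2\hbar_0)}\sqrt{\Omega_s}$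 of finite norm with $F$ a $J_s$-holomorphic function. With $P$ the fiberwise orthogonal projection $\mathcal H^{prQ}\to\mathcal H^Q$, the quantum connection is $\delta^Q=P\circ\delta^{prQ}$. * For $s,s'>0$ the BKS pairing of $\sigma_s=f\sqrt{\Omega_s}$ and $\sigma'_{s'}=f'\sqrt{\Omega_{s'}}$ is $$\langle\sigma_s,\sigma'_{s'}\rangle^{BKS}=\int_{T^*K}\bar f f'\sqrt{\frac{\overline{\Omega_s}\wedge\Omega_{s'}}{b\,\epsilon}}\ \epsilon .$$ * The connection $\delta^{BKS}$ on $\mathcal H^Q$ is defined by the requirement that $\delta^{BKS}_{\partial/\partial s}\sigma'_s\in\mathcal H^Q_s$ and, for all $\tau\in\mathcal H^Q_s$, $$\big\langle\tau,\delta^{BKS}_{\partial/\partial s}\sigma'_s\big\rangle=\frac{\partial}{\partial s'}\Big|_{s'=s}\langle\tau,\sigma'_{s'}\rangle^{BKS}.$$ Then $\delta^{BKS}$ and $\delta^Q$ coincide: for every section $\sigma'$ of $\mathcal H^Q$ and every $s>0$ at which $\sigma'$ is differentiable as a section of $\mathcal H^{prQ}$ (in particular for all smooth sections and all $s>0$),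 the derivatives on the right exist for all $\tau\in\mathcal H^Q_s$, and the one and only vector $\delta^{BKS}_{\partial/\partial s}\sigma'_s$ that they define is $\delta^Q_{\partial/\partial s}\sigma'_s=P\big(\delta^{prQ}_{\partial/\partial s}\sigma'_s\big)$. -/

import Mathlib

open MeasureTheory
open scoped Manifold ContDiff ENNReal

attribute [instance 2000] chartedSpaceSelf

/-! ### Setting

`K` is a compact connected Lie group modelled on the finite dimensional inner product space `E`.
Since the tangent space of `K` at `1` is the model space, the Lie algebra of `K` is `E`, and the
fixed inner product on the Lie algebra is the inner product of `E`. Its Lie bracket is that of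
`GroupLieAlgebra 𝓘(ℝ, E) K`. The cotangent bundle of `K` is identified with `K × E` through left
translations and the inner product, and the tangent space of `K × E` at `p` is identified with
`E × E` through left translations: `(u, a)` stands for the vector whose first component is the
value at `p.1` of the left-invariant vector field of `u` and whose second component is `a`. -/

/-- The complex matrix algebra in which the complexified group is realized. -/
abbrev Mat (N : ℕ) : Type := EuclideanSpace ℂ (Fin N) →L[ℂ] EuclideanSpace ℂ (Fin N)

noncomputable section

section LieGroupPart

variable {n N : ℕ}
  {E : Type*} [NormedAddCommGroup E] [InnerProductSpace ℝ E]
  {K : Type*} [Group K] [TopologicalSpace K] [ChartedSpace E K]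

/-- The adjoint action of `x` on the Lie algebra. -/
def adjointAction (x : K) (u : E) : E :=
  mfderiv 𝓘(ℝ, E) 𝓘(ℝ, E) (fun y : K => x * y * x⁻¹) (1 : K) u

/-- The inner product of the Lie algebra is `Ad`-invariant. -/
def IsAdInvariant (K : Type*) {E : Type*} [NormedAddCommGroup E] [InnerProductSpace ℝ E]
    [Group K] [TopologicalSpace K] [ChartedSpace E K] : Prop :=
  ∀ (x : K) (u v : E), inner ℝ (adjointAction x u) (adjointAction x v) = inner ℝ u v

/-- The derivative of a function on `K × E` at `p` in the direction `(u, a)`. -/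
def dirDeriv {M : Type*} [NormedAddCommGroup M] [NormedSpace ℝ M]
    (f : K × E → M) (p : K × E) (t : E × E) : M :=
  mfderiv (𝓘(ℝ, E).prod 𝓘(ℝ, E)) 𝓘(ℝ, M) f p
    ((mulInvariantVectorField (I := 𝓘(ℝ, E)) (G := K) t.1 p.1, t.2) : E × E)

/-- The canonical symplectic form `ω = -dθ`, where `θ` at `(x, Y)` takes `(u, a)` to `⟪Y, u⟫`.
With `dθ(U, V) = U(θ V) - V(θ U) - θ [U, V]` for the fields `U`, `V` with constant components
`(u, a)`, `(v, b)`, this is `⟪u, b⟫ - ⟪a, v⟫ + ⟪Y, [u, v]⟫`. -/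
def symplecticForm (p : K × E) (t t' : E × E) : ℝ :=
  let u : GroupLieAlgebra 𝓘(ℝ, E) K := t.1
  let v : GroupLieAlgebra 𝓘(ℝ, E) K := t'.1
  let uv : GroupLieAlgebra 𝓘(ℝ, E) K := ⁅u, v⁆
  inner ℝ t.1 t'.2 - inner ℝ t.2 t'.1 + inner ℝ p.2 (show E from uv)

/-- The ordered index set `1, …, n, n+1, …, 2n` (written `Fin n ⊕ Fin n`) cut into the `n`
consecutive pairs `(1, 2), (3, 4), …, (2n-1, 2n)`. -/
def consecutivePairs (n : ℕ) : Fin n × Fin 2 ≃ Fin n ⊕ Fin n :=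
  finProdFinEquiv.trans ((finCongr (Nat.mul_two n)).trans finSumFinEquiv.symm)

/-- The Liouville volume form `ε = ωⁿ / n!` at `p`, evaluated on `2n` vectors:
`(2ⁿ n!)⁻¹ ∑_σ sgn σ ∏_i ω(v_σ(2i-1), v_σ(2i))`. -/
def liouvilleForm (p : K × E) (v : Fin n ⊕ Fin n → E × E) : ℝ :=
  ((2 : ℝ) ^ n * (n.factorial : ℝ))⁻¹ *
    ∑ τ : Equiv.Perm (Fin n ⊕ Fin n), ((Equiv.Perm.sign τ : ℤ) : ℝ) *
      ∏ i : Fin n, symplecticForm p (v (τ (consecutivePairs n (i, 0))))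
        (v (τ (consecutivePairs n (i, 1))))

/-- The left-invariant frame `X₁, …, Xₙ, ∂/∂y¹, …, ∂/∂yⁿ` of the cotangent bundle. -/
def cotangentFrame (X : OrthonormalBasis (Fin n) ℝ E) : Fin n ⊕ Fin n → E × E :=
  Sum.elim (fun j => (X j, 0)) (fun j => (0, X j))

/-- The derivative at the identity of a unitary representation. -/
def repDeriv (ρ : K →* unitary (Mat N)) (u : E) : Mat N :=
  mfderiv 𝓘(ℝ, E) 𝓘(ℝ, Mat N) (fun x : K => (ρ x : Mat N)) (1 : K) u

/-- The map `ψ_s(x, Y) = x e^{isY}`. When `ρ` is faithful (every compact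
Lie group has such a `ρ`), `K` is identified with `ρ(K)`, its Lie algebra with the image of
`repDeriv ρ`, and the complexification of `K` is the complex subgroup `{ρ(x) e^{i dρ(Y)}}` of
`GL(N, ℂ)`, whose Lie algebra is the complex span of the image of `repDeriv ρ`. Up to isomorphism
of complex Lie groups over `K` it does not depend on `ρ`. -/
def psi (ρ : K →* unitary (Mat N)) (s : ℝ) (p : K × E) : Mat N :=
  (ρ p.1 : Mat N) * NormedSpace.exp ((Complex.I * (s : ℂ)) • repDeriv ρ p.2)

/-- The derivative of `ψ_s` at `p`, translated back to the identity of the complexified group: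
`t ↦ ψ_s(p)⁻¹ dψ_s(t)`. -/
def psiLogDeriv (ρ : K →* unitary (Mat N)) (s : ℝ) (p : K × E) (t : E × E) : Mat N :=
  Ring.inverse (psi ρ s p) * dirDeriv (psi ρ s) p t

/-- The complex structure `J_s` on the cotangent bundle, pulled back along `ψ_s`:
`dψ_s(J_s t) = i dψ_s(t)`. -/
def complexStructure (ρ : K →* unitary (Mat N)) (s : ℝ) (p : K × E) (t : E × E) : E × E :=
  Function.invFun (psiLogDeriv ρ s p) (Complex.I • psiLogDeriv ρ s p t)

/-- The left-invariant `J_s`-holomorphic one-forms `η_s¹, …, η_sⁿ`: the pull-backs under `ψ_s` of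
the left-invariant holomorphic one-forms of the complexified group that are dual to the basis
`X₁, …, Xₙ` of its complex Lie algebra, that is `ψ_s⁻¹ dψ_s(t) = ∑ⱼ η_sʲ(t) Xⱼ`. In other words,
`η_sʲ` is complex linear for `J_s`, and it takes the value `δʲₖ` on the vector field that `ψ_s`
maps to the left-invariant field `Xₖ` of the complexified group. -/
def holForm (X : OrthonormalBasis (Fin n) ℝ E) (ρ : K →* unitary (Mat N)) (s : ℝ)
    (p : K × E) (j : Fin n) (t : E × E) : ℂ :=
  Function.invFun (fun c : Fin n → ℂ => ∑ k, c k • repDeriv ρ (X k)) (psiLogDeriv ρ s p t) j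

/-- The wedge product of one-forms: `(α₁ ∧ … ∧ α_m)(v₁, …, v_m) = det (α_i(v_j))`. -/
def wedge {ι T : Type*} [Fintype ι] [DecidableEq ι] (α : ι → T → ℂ) (v : ι → T) : ℂ :=
  Matrix.det (Matrix.of fun i j => α i (v j))

/-- The form `conj Ω_s ∧ Ω_s'` of top degree, where `Ω_s = η_s¹ ∧ … ∧ η_sⁿ`. -/
def OmegaBarWedgeOmega (X : OrthonormalBasis (Fin n) ℝ E) (ρ : K →* unitary (Mat N))
    (s s' : ℝ) (p : K × E) (v : Fin n ⊕ Fin n → E × E) : ℂ :=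
  wedge (Sum.elim (fun j t => starRingEnd ℂ (holForm X ρ s p j t)) (holForm X ρ s' p)) v

/-- The quotient `(conj Ω_s ∧ Ω_s') / (b ε)` of two forms of top degree, where
`b = (2i)ⁿ (-1)^{n(n-1)/2}`. -/
def OmegaRatio (X : OrthonormalBasis (Fin n) ℝ E) (ρ : K →* unitary (Mat N))
    (s s' : ℝ) (p : K × E) : ℂ :=
  OmegaBarWedgeOmega X ρ s s' p (cotangentFrame X) /
    (((2 * Complex.I) ^ n * (-1) ^ (n * (n - 1) / 2)) *
      ((liouvilleForm p (cotangentFrame X) : ℝ) : ℂ))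

/-- The norm `|Ω_s|`, with `conj Ω_s ∧ Ω_s = |Ω_s|² b ε`. -/
def OmegaNorm (X : OrthonormalBasis (Fin n) ℝ E) (ρ : K →* unitary (Mat N))
    (s : ℝ) (p : K × E) : ℝ :=
  √(OmegaRatio X ρ s s p).re

/-- `J_s`-holomorphic functions: smooth functions `F` with `dF ∘ J_s = i dF`. -/
def IsJHolomorphic (ρ : K →* unitary (Mat N)) (s : ℝ) (F : K × E → ℂ) : Prop :=
  ContMDiff (𝓘(ℝ, E).prod 𝓘(ℝ, E)) 𝓘(ℝ, ℂ) ∞ F ∧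
    ∀ (p : K × E) (t : E × E),
      dirDeriv F p (complexStructure ρ s p t) = Complex.I * dirDeriv F p t

end LieGroupPart

section HilbertBundles

variable {n N : ℕ}
  {E : Type*} [NormedAddCommGroup E] [InnerProductSpace ℝ E] [FiniteDimensional ℝ E]
  [MeasurableSpace E] [BorelSpace E]
  {K : Type*} [Group K] [TopologicalSpace K] [ChartedSpace E K] [MeasurableSpace K]
  (X : OrthonormalBasis (Fin n) ℝ E) (ρ : K →* unitary (Mat N)) (μ : Measure K)

/-- The measure of the volume form `ε`: in the frame `X₁, …, Xₙ, ∂/∂y¹, …, ∂/∂yⁿ` it is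
`|ε(X₁, …, ∂/∂yⁿ)| dx dY`, where `dx` is the invariant measure `μ` on `K` and `dY` is Lebesgue
measure on the Lie algebra. -/
def liouvilleMeasure : Measure (K × E) :=
  (μ.prod volume).withDensity fun p => ENNReal.ofReal |liouvilleForm p (cotangentFrame X)|

/-- The measure `|Ω_s| ε`. -/
def fiberMeasure (s : ℝ) : Measure (K × E) :=
  (liouvilleMeasure X μ).withDensity fun p => ENNReal.ofReal (OmegaNorm X ρ s p)

/-- The prequantum Hilbert space over `s`. The section `f √Ω_s` is represented by its coefficient
`f`, and the Hermitian structure is `⟨f √Ω_s, f' √Ω_s⟩ = ∫ conj f f' |Ω_s| ε`. -/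
abbrev PrequantumFiber (s : ℝ) : Type _ := Lp ℂ 2 (fiberMeasure X ρ μ s)

variable {X μ} in
/-- The polarized sections `F e^{-s|Y|²/(2ħ)} √Ω_s` of finite norm, with `F` a `J_s`-holomorphic
function. -/
def polarizedSections (ħ s : ℝ) : Set (PrequantumFiber X ρ μ s) :=
  {σ | ∃ F : K × E → ℂ, IsJHolomorphic ρ s F ∧
    ⇑σ =ᵐ[fiberMeasure X ρ μ s]
      fun p => F p * ((Real.exp (-(s * ‖p.2‖ ^ 2) / (2 * ħ)) : ℝ) : ℂ)}

/-- The quantum Hilbert space over `s`: the Hilbert subspace of the polarized sections (they form a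
linear subspace, which is closed since `L²` limits of holomorphic functions are holomorphic; so
neither the span nor the closure adds anything). -/
def quantumFiber (ħ s : ℝ) : Submodule ℂ (PrequantumFiber X ρ μ s) :=
  (Submodule.span ℂ (polarizedSections ρ ħ s)).topologicalClosure

variable {X ρ μ}

instance (ħ s : ℝ) : CompleteSpace (quantumFiber X ρ μ ħ s) :=
  (Submodule.isClosed_topologicalClosure _).completeSpace_coe

open Classical in
/-- The global trivialization `L²(ε) → ℋ_s`, `g ↦ (g / √|Ω_s|) √Ω_s`. -/
def trivialize (s : ℝ) (g : Lp ℂ 2 (liouvilleMeasure X μ)) : PrequantumFiber X ρ μ s :=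
  if h : MemLp (fun p => g p / ((√(OmegaNorm X ρ s p) : ℝ) : ℂ)) 2 (fiberMeasure X ρ μ s)
  then h.toLp _ else 0

open Classical in
/-- The inverse `f √Ω_s ↦ f √|Ω_s|` of the global trivialization. -/
def untrivialize (s : ℝ) (σ : PrequantumFiber X ρ μ s) : Lp ℂ 2 (liouvilleMeasure X μ) :=
  if h : MemLp (fun p => σ p * ((√(OmegaNorm X ρ s p) : ℝ) : ℂ)) 2 (liouvilleMeasure X μ)
  then h.toLp _ else 0

/-- A section of the prequantum bundle is differentiable at `s` if it is so in the global
trivialization. -/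
def SectionDifferentiableAt (σ : ∀ s : ℝ, PrequantumFiber X ρ μ s) (s : ℝ) : Prop :=
  DifferentiableAt ℝ (fun r => untrivialize r (σ r)) s

/-- The prequantum connection `δ^prQ`, applied to the direction `∂/∂s`: the connection which the
global trivialization carries over from the trivial connection. -/
def prequantumConnection (σ : ∀ s : ℝ, PrequantumFiber X ρ μ s) (s : ℝ) :
    PrequantumFiber X ρ μ s :=
  trivialize s (deriv (fun r => untrivialize r (σ r)) s)

/-- The quantum connection `δ^Q = P ∘ δ^prQ`, where `P` is the orthogonal projection to the
quantum bundle. -/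
def quantumConnection (ħ : ℝ) (σ : ∀ s : ℝ, PrequantumFiber X ρ μ s) (s : ℝ) :
    PrequantumFiber X ρ μ s :=
  (quantumFiber X ρ μ ħ s).starProjection (prequantumConnection σ s)

/-- The BKS pairing
`⟨f √Ω_s, f' √Ω_s'⟩ = ∫ conj f f' √((conj Ω_s ∧ Ω_s') / (b ε)) ε` between two fibers. -/
def bksPairing {s s' : ℝ} (σ : PrequantumFiber X ρ μ s) (σ' : PrequantumFiber X ρ μ s') : ℂ :=
  ∫ p, starRingEnd ℂ (σ p) * σ' p * (OmegaRatio X ρ s s' p) ^ (1 / 2 : ℂ) ∂(liouvilleMeasure X μ)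

/-- `D` is the value at `s` of `δ^BKS` applied to the section `σ` of the quantum bundle and the
direction `∂/∂s`: it is the vector of the quantum fiber for which
`⟨τ, D⟩ = ∂/∂s' ⟨τ, σ_s'⟩^BKS` at `s' = s`, for all `τ` in the quantum fiber over `s`. -/
def IsBKSConnectionValue (ħ : ℝ) (σ : ∀ s : ℝ, PrequantumFiber X ρ μ s) (s : ℝ)
    (D : PrequantumFiber X ρ μ s) : Prop :=
  D ∈ quantumFiber X ρ μ ħ s ∧
    ∀ τ ∈ quantumFiber X ρ μ ħ s,
      HasDerivAt (fun s' : ℝ => bksPairing τ (σ s')) (inner ℂ τ D) s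

end HilbertBundles

end

/-!
Under the global trivialization, `δ^prQ` is the derivative of a curve in the fixed Hilbert space
`L²(ε)`. In the eigenbasis of the Hermitian operator `i ad Y`, with eigenvalues `l_j`, the matrix of
`conj Ω_s ∧ Ω_s'` splits into `2 × 2` blocks, and since `ad Y` is traceless,
`(conj Ω_s ∧ Ω_s') / (b ε) = ∏ sinh ((s + s') l_j / 2) / l_j` at `(x, Y)`. The identity
`sinh² ((a + b) / 2) = sinh a sinh b + sinh² ((a - b) / 2)` compares this with the geometric mean of
its values for `s' = s` and for `s = s'`: the BKS pairing is the inner product of the trivialized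
sections with a kernel that is `1 + O((s' - s)²)` uniformly in `(x, Y)`. The two pairings therefore
have the same first derivative at `s' = s`, namely `⟨τ, δ^prQ σ⟩`, and the vector of a closed
subspace that represents this functional on the subspace is the orthogonal projection of `δ^prQ σ`.
-/

section Exponential

open NormedSpace (exp)

variable {𝔸 : Type*} [NormedRing 𝔸] [NormedAlgebra ℂ 𝔸] [CompleteSpace 𝔸]

theorem contDiff_normedSpace_exp : ContDiff ℂ ω (exp : 𝔸 → 𝔸) :=
  AnalyticOnNhd.contDiff fun Z _ => NormedSpace.exp_analytic (𝕂 := ℂ) Z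

theorem hasFDerivAt_normedSpace_exp (Z : 𝔸) : HasFDerivAt exp (fderiv ℂ exp Z) Z :=
  (contDiff_normedSpace_exp.differentiable (by simp) Z).hasFDerivAt

theorem exp_neg_mul_mul_exp_of_lie_eq_smul {Z W : 𝔸} {c : ℂ} (h : ⁅Z, W⁆ = c • W) :
    exp (-Z) * W * exp Z = Complex.exp (-c) • W := by
  let _ : NormedAlgebra ℚ 𝔸 := NormedAlgebra.restrictScalars ℚ ℂ 𝔸
  have hsemi : SemiconjBy W (Z + algebraMap ℂ 𝔸 c) Z := by
    rw [SemiconjBy, mul_add, ← Algebra.commutes, ← Algebra.smul_def, ← h, Ring.lie_def]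
    abel
  have hexp : exp (Z + algebraMap ℂ 𝔸 c) = Complex.exp c • exp Z := by
    rw [NormedSpace.exp_add_of_commute (Algebra.commutes c Z).symm,
      ← NormedSpace.algebraMap_exp_comm (𝕂 := ℂ), ← Complex.exp_eq_exp_ℂ, ← Algebra.commutes,
      ← Algebra.smul_def]
  have hconj := hsemi.exp_neg_mul_mul_exp_eq_self
  rw [hexp, mul_smul_comm] at hconj
  rw [← smul_right_injective 𝔸 (Complex.exp_ne_zero c) |>.eq_iff, hconj, smul_smul,
    ← Complex.exp_add, add_neg_cancel, Complex.exp_zero, one_smul]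

theorem fderiv_exp_of_commute {Z W : 𝔸} (h : Commute Z W) :
    fderiv ℂ exp Z W = exp Z * W := by
  let _ : NormedAlgebra ℚ 𝔸 := NormedAlgebra.restrictScalars ℚ ℂ 𝔸
  have hline : HasDerivAt (fun t : ℂ => Z + t • W) W 0 := by
    simpa using ((hasDerivAt_id (0 : ℂ)).smul_const W).const_add Z
  have hleft : HasDerivAt (fun t : ℂ => exp (Z + t • W)) (fderiv ℂ exp Z W) 0 :=
    HasFDerivAt.comp_hasDerivAt (0 : ℂ)
      (by simpa using hasFDerivAt_normedSpace_exp Z) hline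
  have hright : HasDerivAt (fun t : ℂ => exp Z * exp (t • W)) (exp Z * W) 0 := by
    simpa using (hasDerivAt_exp_smul_const W (0 : ℂ)).const_mul (exp Z)
  simp_rw [NormedSpace.exp_add_of_commute (h.smul_right _)] at hleft
  exact hleft.unique hright

theorem hasDerivAt_exp_neg_smul_mul_mul_exp_smul (V W : 𝔸) :
    HasDerivAt (fun t : ℂ => exp (-(t • V)) * W * exp (t • V)) ⁅W, V⁆ 0 := by
  let _ : NormedAlgebra ℚ 𝔸 := NormedAlgebra.restrictScalars ℚ ℂ 𝔸
  have hpos : HasDerivAt (fun t : ℂ => exp (t • V)) V 0 := by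
    simpa using hasDerivAt_exp_smul_const V (0 : ℂ)
  have hneg : HasDerivAt (fun t : ℂ => exp (-(t • V))) (-V) 0 := by
    simpa using hasDerivAt_exp_smul_const (-V) (0 : ℂ)
  refine ((hneg.mul_const W).mul hpos).congr_deriv ?_
  simp [Ring.lie_def, sub_eq_add_neg, add_comm]

-- Differentiate `exp (e^{-tV} Z e^{tV}) = e^{-tV} (exp Z) e^{tV}` at `t = 0`.
theorem fderiv_exp_lie (Z V : 𝔸) : fderiv ℂ exp Z ⁅Z, V⁆ = ⁅exp Z, V⁆ := by
  let _ : NormedAlgebra ℚ 𝔸 := NormedAlgebra.restrictScalars ℚ ℂ 𝔸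
  have hconj : ∀ t : ℂ, exp (exp (-(t • V)) * Z * exp (t • V)) =
      exp (-(t • V)) * exp Z * exp (t • V) := fun t =>
    NormedSpace.exp_units_conj' ⟨exp (t • V), exp (-(t • V)),
      by rw [← NormedSpace.exp_add_of_commute (Commute.refl _).neg_right]; simp,
      by rw [← NormedSpace.exp_add_of_commute (Commute.refl _).neg_left]; simp⟩ Z
  have hleft : HasDerivAt (fun t : ℂ => exp (exp (-(t • V)) * Z * exp (t • V)))
      (fderiv ℂ exp Z ⁅Z, V⁆) 0 :=
    HasFDerivAt.comp_hasDerivAt (0 : ℂ) (by simpa using hasFDerivAt_normedSpace_exp Z)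
      (hasDerivAt_exp_neg_smul_mul_mul_exp_smul V Z)
  simp_rw [hconj] at hleft
  exact hleft.unique (hasDerivAt_exp_neg_smul_mul_mul_exp_smul V (exp Z))

/-- The quotient `(1 - e^{-sl}) / l`, extended to `l = 0` by continuity. On the `l`-eigenspace of
`i ad Y` it is the left logarithmic derivative of the exponential at `isY`, applied to `s`. -/
noncomputable def expQuot (s l : ℝ) : ℝ := if l = 0 then s else (1 - Real.exp (-(s * l))) / l

theorem exp_neg_mul_fderiv_exp_smul_of_lie_eq_smul {Z W : 𝔸} {s l : ℝ}
    (h : ⁅Z, W⁆ = ((s * l : ℝ) : ℂ) • W) :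
    exp (-Z) * fderiv ℂ exp Z ((s : ℂ) • W) = (expQuot s l : ℂ) • W := by
  let _ : NormedAlgebra ℚ 𝔸 := NormedAlgebra.restrictScalars ℚ ℂ 𝔸
  have hinv : exp (-Z) * exp Z = 1 := by
    rw [← NormedSpace.exp_add_of_commute (Commute.refl Z).neg_left]; simp
  unfold expQuot
  split_ifs with hl
  · have hcomm : Commute Z W := by
      rwa [hl, mul_zero, Complex.ofReal_zero, zero_smul, Ring.lie_def, sub_eq_zero] at h
    rw [fderiv_exp_of_commute (hcomm.smul_right _), ← mul_assoc, hinv, one_mul]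
  · have hl' : (l : ℂ) ≠ 0 := Complex.ofReal_ne_zero.2 hl
    have hW : (s : ℂ) • W = (l : ℂ)⁻¹ • ⁅Z, W⁆ := by
      rw [h, smul_smul, Complex.ofReal_mul, mul_comm (s : ℂ), inv_mul_cancel_left₀ hl']
    rw [hW, map_smul, fderiv_exp_lie, mul_smul_comm, Ring.lie_def, mul_sub, ← mul_assoc, hinv,
      one_mul, ← mul_assoc, exp_neg_mul_mul_exp_of_lie_eq_smul h, Complex.ofReal_div,
      div_eq_inv_mul, ← smul_smul]
    push_cast
    rw [sub_smul, one_smul]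

end Exponential

section SinhQuot

/-- The quotient `sinh (r l) / l`, extended to `l = 0` by continuity. The densities of
`conj Ω_s ∧ Ω_s'` with respect to `b ε` are products of such factors. -/
noncomputable def sinhQuot (r l : ℝ) : ℝ := if l = 0 then r else Real.sinh (r * l) / l

theorem exp_mul_expQuot_add_exp_mul_expQuot (s s' l : ℝ) :
    Real.exp (s * l) * expQuot s' l + Real.exp (-(s' * l)) * expQuot s (-l) =
      2 * (Real.exp ((s - s') / 2 * l) * sinhQuot ((s + s') / 2) l) := by
  unfold expQuot sinhQuot
  by_cases hl : l = 0
  · simp only [hl, neg_zero, if_true, mul_zero, Real.exp_zero]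
    ring
  have hs : Real.exp ((s - s') / 2 * l) * Real.exp ((s + s') / 2 * l) = Real.exp (s * l) := by
    rw [← Real.exp_add]; ring_nf
  have hs' : Real.exp ((s - s') / 2 * l) * Real.exp (-((s + s') / 2 * l)) =
      Real.exp (-(s' * l)) := by
    rw [← Real.exp_add]; ring_nf
  simp only [hl, neg_eq_zero, if_false, mul_neg, neg_neg, Real.sinh_eq]
  linear_combination (hs' - hs) / l

theorem hasDerivAt_sinhQuot (r l : ℝ) :
    HasDerivAt (fun r => sinhQuot r l) (Real.cosh (r * l)) r := by
  unfold sinhQuot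
  split_ifs with hl
  · simpa [hl] using hasDerivAt_id' r
  · simpa [mul_div_cancel_right₀ _ hl] using ((hasDerivAt_mul_const l).sinh.div_const l)

theorem sinhQuot_zero_left (l : ℝ) : sinhQuot 0 l = 0 := by simp [sinhQuot]

theorem sinhQuot_neg_left (r l : ℝ) : sinhQuot (-r) l = -sinhQuot r l := by
  unfold sinhQuot
  split_ifs
  · rfl
  · rw [neg_mul, Real.sinh_neg, neg_div]

theorem strictMono_sinhQuot (l : ℝ) : StrictMono fun r => sinhQuot r l :=
  strictMono_of_deriv_pos fun r => by
    rw [(hasDerivAt_sinhQuot r l).deriv]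
    exact Real.cosh_pos _

theorem sinhQuot_pos {r : ℝ} (hr : 0 < r) (l : ℝ) : 0 < sinhQuot r l := by
  simpa only [sinhQuot_zero_left] using strictMono_sinhQuot l hr

theorem convexOn_sinhQuot (l : ℝ) : ConvexOn ℝ (Set.Ici 0) fun r => sinhQuot r l := by
  have hderiv : deriv (fun r => sinhQuot r l) = fun r => Real.cosh (r * l) :=
    funext fun r => (hasDerivAt_sinhQuot r l).deriv
  have hdiff : Differentiable ℝ fun r => sinhQuot r l :=
    fun r => (hasDerivAt_sinhQuot r l).differentiableAt
  refine MonotoneOn.convexOn_of_deriv (convex_Ici 0) hdiff.continuous.continuousOn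
    hdiff.differentiableOn ?_
  rw [hderiv, interior_Ici]
  intro r hr r' hr' hrr'
  rw [Real.cosh_le_cosh, abs_mul, abs_mul, abs_of_pos (Set.mem_Ioi.1 hr),
    abs_of_pos (Set.mem_Ioi.1 hr')]
  gcongr

theorem sinhQuot_mul_le {t r : ℝ} (ht0 : 0 ≤ t) (ht1 : t ≤ 1) (hr : 0 ≤ r) (l : ℝ) :
    sinhQuot (t * r) l ≤ t * sinhQuot r l := by
  simpa [sinhQuot_zero_left] using (convexOn_sinhQuot l).2 hr (Set.self_mem_Ici (a := (0 : ℝ)))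
    ht0 (sub_nonneg.2 ht1) (add_sub_cancel t 1)

theorem sinhQuot_sub_mul_sinhQuot_add (r d l : ℝ) :
    sinhQuot (r - d) l * sinhQuot (r + d) l = sinhQuot r l ^ 2 - sinhQuot d l ^ 2 := by
  unfold sinhQuot
  split_ifs
  · ring
  · have hr := Real.cosh_sq (r * l)
    have hd := Real.cosh_sq (d * l)
    rw [sub_mul, add_mul, Real.sinh_sub, Real.sinh_add]
    linear_combination (Real.sinh (r * l) ^ 2 * hd - Real.sinh (d * l) ^ 2 * hr) / l ^ 2

theorem sinhQuot_midpoint_sq (s s' l : ℝ) :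
    sinhQuot ((s + s') / 2) l ^ 2 =
      sinhQuot s l * sinhQuot s' l + sinhQuot ((s' - s) / 2) l ^ 2 := by
  have h := sinhQuot_sub_mul_sinhQuot_add ((s + s') / 2) ((s' - s) / 2) l
  rw [show (s + s') / 2 - (s' - s) / 2 = s by ring,
    show (s + s') / 2 + (s' - s) / 2 = s' by ring] at h
  rw [h, sub_add_cancel]

theorem sinhQuot_half_sub_sq_le {s s' : ℝ} (hs : 0 < s) (hs' : |s' - s| ≤ s / 2) (l : ℝ) :
    sinhQuot ((s' - s) / 2) l ^ 2 ≤ ((s' - s) / s) ^ 2 * (sinhQuot s l * sinhQuot s' l) := by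
  have habs : sinhQuot ((s' - s) / 2) l ^ 2 = sinhQuot (|s' - s| / s * (s / 2)) l ^ 2 := by
    rw [show |s' - s| / s * (s / 2) = |s' - s| / 2 by field_simp]
    rcases abs_choice (s' - s) with h | h <;> rw [h]
    rw [neg_div, sinhQuot_neg_left, neg_sq]
  have hle : sinhQuot (|s' - s| / s * (s / 2)) l ≤ |s' - s| / s * sinhQuot (s / 2) l :=
    sinhQuot_mul_le (by positivity) (by rw [div_le_one hs]; linarith) (by positivity) l
  have hnonneg : 0 ≤ sinhQuot (|s' - s| / s * (s / 2)) l := by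
    simpa only [sinhQuot_zero_left] using
      (strictMono_sinhQuot l).monotone (show 0 ≤ |s' - s| / s * (s / 2) by positivity)
  have hpos : 0 < sinhQuot (s / 2) l := sinhQuot_pos (half_pos hs) l
  have hles : sinhQuot (s / 2) l ≤ sinhQuot s l :=
    (strictMono_sinhQuot l).monotone (by linarith)
  have hles' : sinhQuot (s / 2) l ≤ sinhQuot s' l :=
    (strictMono_sinhQuot l).monotone (by linarith [(abs_le.1 hs').1])
  calc sinhQuot ((s' - s) / 2) l ^ 2 ≤ (|s' - s| / s * sinhQuot (s / 2) l) ^ 2 := by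
        rw [habs]; gcongr
    _ = ((s' - s) / s) ^ 2 * (sinhQuot (s / 2) l * sinhQuot (s / 2) l) := by
        rw [mul_pow, div_pow, div_pow, sq_abs, sq (sinhQuot _ _)]
    _ ≤ ((s' - s) / s) ^ 2 * (sinhQuot s l * sinhQuot s' l) := by
        gcongr
        exact hpos.le.trans hles

theorem one_add_pow_le_of_le_one {t : ℝ} (h0 : 0 ≤ t) (h1 : t ≤ 1) (n : ℕ) :
    (1 + t) ^ n ≤ 1 + (2 ^ n - 1) * t := by
  have h := (convexOn_pow (𝕜 := ℝ) n).2 (zero_le_one : (0 : ℝ) ≤ 1) (zero_le_two : (0 : ℝ) ≤ 2)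
    (sub_nonneg.2 h1) h0 (sub_add_cancel 1 t)
  simp only [smul_eq_mul, one_pow] at h
  calc (1 + t) ^ n = ((1 - t) * 1 + t * 2) ^ n := by ring
    _ ≤ (1 - t) * 1 + t * 2 ^ n := h
    _ = 1 + (2 ^ n - 1) * t := by ring

theorem abs_sqrt_div_sqrt_sqrt_mul_sub_one_le {a b m C : ℝ} (ha : 0 < a) (hb : 0 < b) (hm : 0 ≤ m)
    (hlow : a * b ≤ m ^ 2) (hupp : m ^ 2 ≤ C * (a * b)) :
    |√m / (√√a * √√b) - 1| ≤ C - 1 := by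
  have hquot : √m / (√√a * √√b) = √√(m ^ 2 / (a * b)) := by
    rw [Real.sqrt_div' _ (by positivity), Real.sqrt_div' _ (by positivity), Real.sqrt_sq hm,
      Real.sqrt_mul ha.le, Real.sqrt_mul (Real.sqrt_nonneg a)]
  have hone : 1 ≤ √(m ^ 2 / (a * b)) :=
    Real.one_le_sqrt.2 ((one_le_div (by positivity)).2 hlow)
  have hsqrt : √√(m ^ 2 / (a * b)) ≤ √(m ^ 2 / (a * b)) := Real.sqrt_le_self_iff.2 (.inr hone)
  have hle : √(m ^ 2 / (a * b)) ≤ m ^ 2 / (a * b) :=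
    Real.sqrt_le_self_iff.2 (.inr (Real.one_le_sqrt.1 hone))
  have hC : m ^ 2 / (a * b) ≤ C := (div_le_iff₀ (by positivity)).2 hupp
  rw [hquot, abs_of_nonneg (sub_nonneg.2 (Real.one_le_sqrt.2 hone))]
  linarith

theorem abs_sqrt_prod_sinhQuot_div_sub_one_le {ι : Type*} [Fintype ι] {s s' : ℝ} (hs : 0 < s)
    (hs' : |s' - s| ≤ s / 2) (l : ι → ℝ) :
    |√(∏ j, sinhQuot ((s + s') / 2) (l j)) /
      (√√(∏ j, sinhQuot s (l j)) * √√(∏ j, sinhQuot s' (l j))) - 1| ≤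
      (2 ^ Fintype.card ι - 1) * ((s' - s) / s) ^ 2 := by
  have hs'0 : 0 < s' := by linarith [(abs_le.1 hs').1]
  have ht1 : ((s' - s) / s) ^ 2 ≤ 1 := by
    rw [sq_le_one_iff_abs_le_one, abs_div, abs_of_pos hs, div_le_one hs]
    linarith
  have hpos : ∀ j, 0 < sinhQuot s (l j) * sinhQuot s' (l j) := fun j =>
    mul_pos (sinhQuot_pos hs _) (sinhQuot_pos hs'0 _)
  refine (abs_sqrt_div_sqrt_sqrt_mul_sub_one_le (C := (1 + ((s' - s) / s) ^ 2) ^ Fintype.card ι)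
    (Finset.prod_pos fun j _ => sinhQuot_pos hs _) (Finset.prod_pos fun j _ => sinhQuot_pos hs'0 _)
    (Finset.prod_pos fun j _ => sinhQuot_pos (by linarith) _).le ?_ ?_).trans
    (sub_le_iff_le_add'.2 (one_add_pow_le_of_le_one (sq_nonneg _) ht1 _))
  · rw [← Finset.prod_mul_distrib, ← Finset.prod_pow]
    refine Finset.prod_le_prod (fun j _ => (hpos j).le) fun j _ => ?_
    rw [sinhQuot_midpoint_sq]
    exact le_add_of_nonneg_right (sq_nonneg _)
  · rw [← Finset.card_univ, ← Finset.prod_const, ← Finset.prod_mul_distrib, ← Finset.prod_pow,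
      ← Finset.prod_mul_distrib]
    refine Finset.prod_le_prod (fun j _ => sq_nonneg _) fun j _ => ?_
    rw [sinhQuot_midpoint_sq, add_mul, one_mul]
    gcongr
    exact sinhQuot_half_sub_sq_le hs hs' (l j)

end SinhQuot

section PairPermutations

/-- The index set `ι × Fin 2`, with `(i, 0)` and `(i, 1)` sent to the two copies of `i`. -/
def matchedPairs (ι : Type*) : ι × Fin 2 ≃ ι ⊕ ι where
  toFun x := if x.2 = 0 then Sum.inl x.1 else Sum.inr x.1
  invFun := Sum.elim (fun i => (i, 0)) (fun i => (i, 1))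
  left_inv := by
    rintro ⟨i, b⟩
    fin_cases b <;> simp
  right_inv := by
    rintro (i | i) <;> simp

/-- The permutation `1, 2, …, 2n ↦ 1, n+1, 2, n+2, …, n, 2n` of `Fin (n * 2)`, which sends the
`i`-th consecutive pair to the two copies of `i` in `Fin n ⊕ Fin n`. -/
def unshuffle (n : ℕ) : Equiv.Perm (Fin (n * 2)) :=
  finProdFinEquiv.symm.trans
    ((matchedPairs (Fin n)).trans (finSumFinEquiv.trans (finCongr (Nat.mul_two n).symm)))

theorem unshuffle_finProdFinEquiv_val {n : ℕ} (i : Fin n) (b : Fin 2) :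
    (unshuffle n (finProdFinEquiv (i, b)) : ℕ) = i + n * b := by
  fin_cases b <;> simp [unshuffle, matchedPairs, add_comm]

theorem sign_eq_prod_ite_lt {n : ℕ} (σ : Equiv.Perm (Fin n)) :
    Equiv.Perm.sign σ = ∏ x, ∏ y, if x < y then (if σ x < σ y then 1 else -1) else 1 := by
  simp_rw [Equiv.Perm.sign_eq_prod_prod_Ioi, ← Finset.prod_filter, Finset.filter_lt_eq_Ioi]

theorem prod_prod_ite_lt_neg_one (n : ℕ) :
    ∏ i : Fin n, ∏ j : Fin n, (if i < j then (-1 : ℤˣ) else 1) = (-1) ^ (n * (n - 1) / 2) := by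
  have hcol : ∀ j : Fin n, ∏ i : Fin n, (if i < j then (-1 : ℤˣ) else 1) = (-1) ^ (j : ℕ) := by
    intro j
    rw [← Finset.prod_filter, Finset.prod_const, Finset.filter_gt_eq_Iio, Fin.card_Iio]
  rw [Finset.prod_comm, Finset.prod_congr rfl fun j _ => hcol j, Finset.prod_pow_eq_pow_sum,
    Fin.sum_univ_eq_sum_range fun i => i, Finset.sum_range_id]

-- The pairs `i < j` contribute one inversion each: the second element of `i` passes the first of
-- `j`.
theorem prod_unshuffle_inversions {n : ℕ} (i j : Fin n) :
    ∏ b : Fin 2, ∏ d : Fin 2, (if finProdFinEquiv (i, b) < finProdFinEquiv (j, d) then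
      (if unshuffle n (finProdFinEquiv (i, b)) < unshuffle n (finProdFinEquiv (j, d))
        then (1 : ℤˣ) else -1) else 1) = if i < j then -1 else 1 := by
  simp only [Fin.prod_univ_two, Fin.lt_def, unshuffle_finProdFinEquiv_val,
    finProdFinEquiv_apply_val, Fin.val_zero, Fin.val_one]
  have := i.2
  have := j.2
  split_ifs <;> first | omega | simp

theorem sign_unshuffle (n : ℕ) :
    Equiv.Perm.sign (unshuffle n) = (-1) ^ (n * (n - 1) / 2) := by
  rw [sign_eq_prod_ite_lt, ← prod_prod_ite_lt_neg_one, ← finProdFinEquiv.prod_comp,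
    Fintype.prod_prod_type]
  refine Finset.prod_congr rfl fun i _ => ?_
  simp_rw [← prod_unshuffle_inversions, Finset.prod_comm (s := (Finset.univ : Finset (Fin n)))]
  refine Finset.prod_congr rfl fun b _ => ?_
  rw [← finProdFinEquiv.prod_comp, Fintype.prod_prod_type, Finset.prod_comm]

theorem sign_consecutivePairs_symm_trans_matchedPairs (n : ℕ) :
    Equiv.Perm.sign ((consecutivePairs n).symm.trans (matchedPairs (Fin n))) =
      (-1) ^ (n * (n - 1) / 2) := by
  rw [← sign_unshuffle]
  refine Equiv.Perm.sign_eq_sign_of_equiv _ _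
    (finSumFinEquiv.trans (finCongr (Nat.mul_two n).symm)) fun x => ?_
  simp only [unshuffle, consecutivePairs, Equiv.trans_apply, Equiv.symm_trans_apply]
  congr 3

variable {ι : Type*}

/-- The permutations of `ι × Fin 2` that respect the partition into the pairs `{i} × Fin 2`: the
pairs are permuted by `x.1`, and `x.2 i` acts inside the `i`-th pair. -/
def pairPerm (x : Equiv.Perm ι × (ι → Equiv.Perm (Fin 2))) : Equiv.Perm (ι × Fin 2) :=
  (Equiv.prodCongrRight x.2).trans (Equiv.prodCongrLeft fun _ => x.1)

theorem pairPerm_apply (x : Equiv.Perm ι × (ι → Equiv.Perm (Fin 2))) (i : ι) (b : Fin 2) :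
    pairPerm x (i, b) = (x.1 i, x.2 i b) := rfl

theorem pairPerm_injective : Function.Injective (pairPerm (ι := ι)) := by
  intro x y hxy
  have h : ∀ i b, x.1 i = y.1 i ∧ x.2 i b = y.2 i b := fun i b => by
    simpa [pairPerm_apply] using congrArg (fun π => π (i, b)) hxy
  exact Prod.ext (Equiv.ext fun i => (h i 0).1)
    (funext fun i => Equiv.ext fun b => (h i b).2)

theorem mem_range_pairPerm [Finite ι] {π : Equiv.Perm (ι × Fin 2)}
    (h : ∀ i, (π (i, 0)).1 = (π (i, 1)).1) : π ∈ Set.range pairPerm := by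
  have hfst : ∀ i b, (π (i, b)).1 = (π (i, 0)).1 := fun i b => by
    fin_cases b
    exacts [rfl, (h i).symm]
  have hpairs : Function.Bijective fun i => (π (i, 0)).1 := by
    refine Finite.surjective_iff_bijective.1 fun j => ⟨(π.symm (j, 0)).1, ?_⟩
    rw [← hfst _ (π.symm (j, 0)).2, Prod.mk.eta, Equiv.apply_symm_apply]
  have hinner : ∀ i, Function.Bijective fun b => (π (i, b)).2 := by
    refine fun i => Finite.injective_iff_bijective.1 fun b d hbd => ?_
    have : π (i, b) = π (i, d) := Prod.ext ((hfst i b).trans (hfst i d).symm) hbd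
    simpa using π.injective this
  refine ⟨(Equiv.ofBijective _ hpairs, fun i => Equiv.ofBijective _ (hinner i)), ?_⟩
  ext1 ⟨i, b⟩
  exact Prod.ext (hfst i b).symm rfl

-- Counting: exactly one half of the values of `π` has second component `1`.
theorem snd_apply_ne_snd_apply [Finite ι] {π : Equiv.Perm (ι × Fin 2)}
    (h : ∀ i, ¬((π (i, 0)).2 = 1 ∧ (π (i, 1)).2 = 1)) (i : ι) :
    (π (i, 0)).2 ≠ (π (i, 1)).2 := by
  cases nonempty_fintype ι
  have hle : ∀ i ∈ Finset.univ, ((π (i, 0)).2 : ℕ) + ((π (i, 1)).2 : ℕ) ≤ 1 := fun i _ => by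
    have := h i
    omega
  have hsum : ∑ i, (((π (i, 0)).2 : ℕ) + ((π (i, 1)).2 : ℕ)) = ∑ _i : ι, 1 := by
    have := Equiv.sum_comp π fun x : ι × Fin 2 => (x.2 : ℕ)
    rw [Fintype.sum_prod_type, Fintype.sum_prod_type] at this
    simpa [Fin.sum_univ_two] using this
  have := (Finset.sum_eq_sum_iff_of_le hle).1 hsum i (Finset.mem_univ i)
  omega

variable [Fintype ι] {R : Type*} [CommRing R] {w : ι × Fin 2 → ι × Fin 2 → R}

theorem prod_eq_zero_of_notMem_range_pairPerm (h01 : ∀ i j, i ≠ j → w (i, 0) (j, 1) = 0)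
    (h10 : ∀ i j, i ≠ j → w (i, 1) (j, 0) = 0) (h11 : ∀ i j, w (i, 1) (j, 1) = 0)
    {π : Equiv.Perm (ι × Fin 2)} (hπ : π ∉ Set.range pairPerm) :
    ∏ i, w (π (i, 0)) (π (i, 1)) = 0 := by
  by_contra hprod
  have hne : ∀ i, w (π (i, 0)) (π (i, 1)) ≠ 0 := fun i hi =>
    hprod (Finset.prod_eq_zero (Finset.mem_univ i) hi)
  have hsnd := snd_apply_ne_snd_apply (π := π) fun i ⟨h0, h1⟩ => hne i <| by
    rw [← Prod.mk.eta (p := π (i, 0)), ← Prod.mk.eta (p := π (i, 1)), h0, h1, h11]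
  refine hπ (mem_range_pairPerm fun i => by_contra fun hfst => hne i ?_)
  rw [← Prod.mk.eta (p := π (i, 0)), ← Prod.mk.eta (p := π (i, 1))]
  obtain ⟨h0, h1⟩ | ⟨h0, h1⟩ : ((π (i, 0)).2 = 0 ∧ (π (i, 1)).2 = 1) ∨
      ((π (i, 0)).2 = 1 ∧ (π (i, 1)).2 = 0) := by
    have := hsnd i
    omega
  · rw [h0, h1, h01 _ _ hfst]
  · rw [h0, h1, h10 _ _ hfst]

variable [DecidableEq ι]

theorem sign_pairPerm (x : Equiv.Perm ι × (ι → Equiv.Perm (Fin 2))) :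
    Equiv.Perm.sign (pairPerm x) = ∏ i, Equiv.Perm.sign (x.2 i) := by
  rw [pairPerm, Equiv.Perm.sign_trans, Equiv.Perm.sign_prodCongrLeft,
    Equiv.Perm.sign_prodCongrRight]
  simp

theorem sign_mul_prod_pairPerm (h01 : ∀ i, w (i, 0) (i, 1) = 1) (h10 : ∀ i, w (i, 1) (i, 0) = -1)
    (x : Equiv.Perm ι × (ι → Equiv.Perm (Fin 2))) :
    ((Equiv.Perm.sign (pairPerm x) : ℤ) : R) *
      ∏ i, w (pairPerm x (i, 0)) (pairPerm x (i, 1)) = 1 := by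
  have hcases : ∀ f : Equiv.Perm (Fin 2), (f 0 = 0 ∧ f 1 = 1 ∧ Equiv.Perm.sign f = 1) ∨
      (f 0 = 1 ∧ f 1 = 0 ∧ Equiv.Perm.sign f = -1) := by decide
  rw [sign_pairPerm, Units.coe_prod, Int.cast_prod, ← Finset.prod_mul_distrib]
  refine Finset.prod_eq_one fun i _ => ?_
  rcases hcases (x.2 i) with ⟨h0, h1, hs⟩ | ⟨h0, h1, hs⟩ <;>
    simp [pairPerm_apply, h0, h1, hs, h01, h10]

-- Only the permutations `pairPerm x` contribute, each of them `1`.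
theorem sum_perm_sign_mul_prod_of_dual_frames
    (h01 : ∀ i j, w (i, 0) (j, 1) = if i = j then 1 else 0)
    (h10 : ∀ i j, w (i, 1) (j, 0) = if i = j then -1 else 0) (h11 : ∀ i j, w (i, 1) (j, 1) = 0) :
    ∑ π : Equiv.Perm (ι × Fin 2), ((Equiv.Perm.sign π : ℤ) : R) *
      ∏ i, w (π (i, 0)) (π (i, 1)) = 2 ^ Fintype.card ι * (Fintype.card ι).factorial := by
  have hone := sign_mul_prod_pairPerm (w := w) (fun i => by rw [h01, if_pos rfl])
    (fun i => by rw [h10, if_pos rfl])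
  have hzero : ∀ π ∉ Set.range (pairPerm (ι := ι)), ∏ i, w (π (i, 0)) (π (i, 1)) = 0 :=
    fun π => prod_eq_zero_of_notMem_range_pairPerm (fun i j h => by rw [h01, if_neg h])
      (fun i j h => by rw [h10, if_neg h]) h11
  rw [← Finset.sum_of_injOn (s := Finset.univ) (t := Finset.univ) (f := fun _ => (1 : R)) pairPerm
    pairPerm_injective.injOn (fun _ _ => Finset.mem_coe.2 (Finset.mem_univ _))
    (fun π _ hπ => by rw [hzero π (by simpa using hπ), mul_zero]) (fun x _ => (hone x).symm)]
  simp [Fintype.card_perm, mul_comm]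

end PairPermutations

section LiouvilleForm

variable {n : ℕ}
  {E : Type*} [NormedAddCommGroup E] [InnerProductSpace ℝ E]
  {K : Type*} [Group K] [TopologicalSpace K] [ChartedSpace E K]

theorem mulInvariantVectorField_zero :
    mulInvariantVectorField (I := 𝓘(ℝ, E)) (G := K) (0 : E) = 0 := by
  ext x
  exact map_zero (mfderiv 𝓘(ℝ, E) 𝓘(ℝ, E) (fun y : K => x * y) 1)

theorem bracket_zero_left (v : E) :
    (Bracket.bracket (L := GroupLieAlgebra 𝓘(ℝ, E) K) (M := GroupLieAlgebra 𝓘(ℝ, E) K)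
      (0 : E) v : E) = 0 := by
  change VectorField.mlieBracket 𝓘(ℝ, E) (mulInvariantVectorField (0 : E)) _ (1 : K) = 0
  rw [mulInvariantVectorField_zero, VectorField.mlieBracket_zero_left]
  rfl

theorem bracket_zero_right (v : E) :
    (Bracket.bracket (L := GroupLieAlgebra 𝓘(ℝ, E) K) (M := GroupLieAlgebra 𝓘(ℝ, E) K)
      v (0 : E) : E) = 0 := by
  change VectorField.mlieBracket 𝓘(ℝ, E) _ (mulInvariantVectorField (0 : E)) (1 : K) = 0
  rw [mulInvariantVectorField_zero, VectorField.mlieBracket_zero_right]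
  rfl

theorem symplecticForm_eq (p : K × E) (u a v b : E) :
    symplecticForm p (u, a) (v, b) = inner ℝ u b - inner ℝ a v + inner ℝ p.2
      (Bracket.bracket (L := GroupLieAlgebra 𝓘(ℝ, E) K) (M := GroupLieAlgebra 𝓘(ℝ, E) K) u v : E) :=
  rfl

theorem symplecticForm_fst_snd (p : K × E) (u b : E) :
    symplecticForm p (u, 0) (0, b) = inner ℝ u b := by
  rw [symplecticForm_eq, bracket_zero_right, inner_zero_left, sub_zero]
  exact add_eq_left.2 (inner_zero_right (𝕜 := ℝ) p.2)

theorem symplecticForm_snd_fst (p : K × E) (a v : E) :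
    symplecticForm p (0, a) (v, 0) = -inner ℝ a v := by
  rw [symplecticForm_eq, bracket_zero_left, inner_zero_left, zero_sub]
  exact add_eq_left.2 (inner_zero_right (𝕜 := ℝ) p.2)

theorem symplecticForm_snd_snd (p : K × E) (a b : E) :
    symplecticForm p (0, a) (0, b) = 0 := by
  rw [symplecticForm_eq, bracket_zero_right, inner_zero_left, inner_zero_right, sub_zero, zero_add]
  exact inner_zero_right (𝕜 := ℝ) p.2

theorem liouvilleForm_cotangentFrame (X : OrthonormalBasis (Fin n) ℝ E) (p : K × E) :
    liouvilleForm p (cotangentFrame X) = (-1) ^ (n * (n - 1) / 2) := by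
  set w : Fin n × Fin 2 → Fin n × Fin 2 → ℝ := fun x y =>
    symplecticForm p (cotangentFrame X (matchedPairs _ x)) (cotangentFrame X (matchedPairs _ y))
  have hdual := sum_perm_sign_mul_prod_of_dual_frames (w := w)
    (fun i j => (symplecticForm_fst_snd p (X i) (X j)).trans (X.inner_eq_ite i j))
    (fun i j => (symplecticForm_snd_fst p (X i) (X j)).trans <| by
      rw [X.inner_eq_ite]
      split_ifs <;> simp)
    (fun i j => symplecticForm_snd_snd p (X i) (X j))
  have hsign : ∀ π, Equiv.Perm.sign (Equiv.equivCongr (consecutivePairs n) (matchedPairs _) π) =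
      (-1) ^ (n * (n - 1) / 2) * Equiv.Perm.sign π := fun π => by
    rw [← sign_consecutivePairs_symm_trans_matchedPairs, mul_comm, ← Equiv.Perm.sign_trans_trans]
    rfl
  rw [liouvilleForm, ← (Equiv.equivCongr (consecutivePairs n) (matchedPairs (Fin n))).sum_comp]
  simp only [hsign, Equiv.equivCongr_apply_apply, Equiv.symm_apply_apply, Units.val_mul,
    Int.cast_mul, mul_assoc]
  rw [← Finset.mul_sum, hdual, Fintype.card_fin]
  push_cast
  field_simp

end LiouvilleForm

section Representation

variable {N : ℕ}
  {E : Type*} [NormedAddCommGroup E] [InnerProductSpace ℝ E]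
  {K : Type*} [Group K] [TopologicalSpace K] [ChartedSpace E K]

/-- The derivative at the identity of a unitary representation, as a continuous linear map. -/
noncomputable def repDerivL (ρ : K →* unitary (Mat N)) : E →L[ℝ] Mat N :=
  mfderiv 𝓘(ℝ, E) 𝓘(ℝ, Mat N) (fun x : K => (ρ x : Mat N)) (1 : K)

theorem repDerivL_apply (ρ : K →* unitary (Mat N)) (u : E) : repDerivL ρ u = repDeriv ρ u := rfl

theorem hasMFDerivAt_rep {ρ : K →* unitary (Mat N)}
    (hρ : ContMDiff 𝓘(ℝ, E) 𝓘(ℝ, Mat N) ∞ fun x : K => (ρ x : Mat N)) (x : K) :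
    HasMFDerivAt 𝓘(ℝ, E) 𝓘(ℝ, Mat N) (fun x : K => (ρ x : Mat N)) x
      (mfderiv 𝓘(ℝ, E) 𝓘(ℝ, Mat N) (fun x : K => (ρ x : Mat N)) x) :=
  ((hρ x).mdifferentiableAt (by simp)).hasMFDerivAt

theorem mulInvariantVectorField_apply_one (u : E) :
    mulInvariantVectorField (I := 𝓘(ℝ, E)) (G := K) u 1 = u := by
  change mfderiv 𝓘(ℝ, E) 𝓘(ℝ, E) (fun x : K => 1 * x) 1 u = u
  have hid : (fun x : K => 1 * x) = id := funext one_mul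
  rw [hid]
  exact congrArg (fun L => L u) (mfderiv_id (I := 𝓘(ℝ, E)) (M := K) (x := 1))

variable [LieGroup 𝓘(ℝ, E) ∞ K]

variable {ρ : K →* unitary (Mat N)}
  (hρ : ContMDiff 𝓘(ℝ, E) 𝓘(ℝ, Mat N) ∞ fun x : K => (ρ x : Mat N))
include hρ

theorem mfderiv_rep_mulInvariantVectorField (x : K) (u : E) :
    (mfderiv 𝓘(ℝ, E) 𝓘(ℝ, Mat N) (fun x : K => (ρ x : Mat N)) x
      (mulInvariantVectorField (I := 𝓘(ℝ, E)) (G := K) u x) : Mat N) =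
      (ρ x : Mat N) * repDeriv ρ u := by
  have hmul : HasMFDerivAt 𝓘(ℝ, E) 𝓘(ℝ, E) (fun y : K => x * y) 1 _ :=
    ((contMDiff_mul_left (I := 𝓘(ℝ, E)) (n := ∞) (a := x) (1 : K)).mdifferentiableAt
      (by simp)).hasMFDerivAt
  have hleft := HasMFDerivAt.comp (g := fun x : K => (ρ x : Mat N)) (1 : K)
    (hasMFDerivAt_rep hρ (x * 1)) hmul
  have hright := HasMFDerivAt.comp (1 : K)
    ((ContinuousLinearMap.mul ℝ (Mat N) (ρ x : Mat N)).hasMFDerivAt) (hasMFDerivAt_rep hρ 1)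
  have hfun : (fun y : K => (ρ y : Mat N)) ∘ (fun y => x * y) =
      ContinuousLinearMap.mul ℝ (Mat N) (ρ x : Mat N) ∘ fun y : K => (ρ y : Mat N) := by
    ext1 y
    simp
  rw [hfun, mul_one] at hleft
  exact congrArg (fun L => L u) (hasMFDerivAt_unique hleft hright)

theorem repDeriv_adjointAction (x : K) (u : E) :
    repDeriv ρ (adjointAction x u) = ρ x * repDeriv ρ u * star (ρ x : Mat N) := by
  have hconj : HasMFDerivAt 𝓘(ℝ, E) 𝓘(ℝ, E) (fun y : K => x * y * x⁻¹) 1 _ :=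
    (((contMDiff_mul_right (I := 𝓘(ℝ, E)) (n := ∞) (a := x⁻¹)).comp
      (contMDiff_mul_left (I := 𝓘(ℝ, E)) (n := ∞) (a := x)) (1 : K)).mdifferentiableAt
      (by simp)).hasMFDerivAt
  have hleft := HasMFDerivAt.comp (g := fun x : K => (ρ x : Mat N)) (1 : K)
    (hasMFDerivAt_rep hρ (x * 1 * x⁻¹)) hconj
  have hright := HasMFDerivAt.comp (1 : K)
    (ContinuousLinearMap.mulLeftRight ℝ (Mat N) (ρ x) (star (ρ x : Mat N))).hasMFDerivAt
    (hasMFDerivAt_rep hρ 1)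
  have hfun : (fun y : K => (ρ y : Mat N)) ∘ (fun y => x * y * x⁻¹) =
      ContinuousLinearMap.mulLeftRight ℝ (Mat N) (ρ x) (star (ρ x : Mat N)) ∘
        fun y : K => (ρ y : Mat N) := by
    ext1 y
    simp [← Unitary.star_eq_inv]
  rw [hfun, mul_one, mul_inv_cancel] at hleft
  exact congrArg (fun L => L u) (hasMFDerivAt_unique hleft hright)

omit hρ in
theorem exists_isMIntegralCurveAt_mulInvariantVectorField [CompleteSpace E] (u : E) :
    ∃ γ : ℝ → K, γ 0 = 1 ∧ IsMIntegralCurveAt (I := 𝓘(ℝ, E)) γ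
      (fun x => mulInvariantVectorField (I := 𝓘(ℝ, E)) (G := K) u x) 0 := by
  have : LieGroup 𝓘(ℝ, E) (minSmoothness ℝ 3) K := by
    rw [minSmoothness_of_isRCLikeNormedField]
    infer_instance
  have : IsManifold 𝓘(ℝ, E) 1 K :=
    IsManifold.of_le (n := ∞) (by exact_mod_cast (le_top : (1 : ℕ∞) ≤ ⊤))
  refine exists_isMIntegralCurveAt_of_contMDiffAt_boundaryless (t₀ := 0)
    ((contMDiffAt_mulInvariantVectorField (I := 𝓘(ℝ, E)) (G := K) u (g := 1)).of_le ?_)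
  rw [minSmoothness_of_isRCLikeNormedField]
  exact_mod_cast (by norm_num : (1 : ℕ) ≤ 2)

theorem hasDerivAt_rep_comp_of_isMIntegralCurveAt {γ : ℝ → K} {u : E} {t₀ : ℝ}
    (hγ : IsMIntegralCurveAt (I := 𝓘(ℝ, E)) γ
      (fun x => mulInvariantVectorField (I := 𝓘(ℝ, E)) (G := K) u x) t₀) :
    ∀ᶠ t in nhds t₀,
      HasDerivAt (fun t => (ρ (γ t) : Mat N)) ((ρ (γ t) : Mat N) * repDeriv ρ u) t := by
  filter_upwards [hγ] with t ht
  have hcomp : HasFDerivAt (fun t => (ρ (γ t) : Mat N)) (_ : ℝ →L[ℝ] Mat N) t :=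
    hasMFDerivAt_iff_hasFDerivAt.1 ((hasMFDerivAt_rep hρ (γ t)).comp t ht)
  refine hcomp.hasDerivAt.congr_deriv ?_
  rw [← mfderiv_rep_mulInvariantVectorField hρ]
  exact congrArg (mfderiv 𝓘(ℝ, E) 𝓘(ℝ, Mat N) (fun x : K => (ρ x : Mat N)) (γ t))
    (one_smul ℝ (mulInvariantVectorField (I := 𝓘(ℝ, E)) (G := K) u (γ t)))

-- A vector in the kernel has a one-parameter group on which `ρ` is constant.
theorem repDeriv_injective [CompleteSpace E] (hinj : Function.Injective ρ) :
    Function.Injective (repDeriv (E := E) ρ) := by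
  refine (injective_iff_map_eq_zero (repDerivL ρ)).2 fun u hu => ?_
  rw [repDerivL_apply] at hu
  obtain ⟨γ, hγ0, hγ⟩ := exists_isMIntegralCurveAt_mulInvariantVectorField (K := K) u
  have hderiv := hasDerivAt_rep_comp_of_isMIntegralCurveAt hρ hγ
  simp only [hu, mul_zero] at hderiv
  obtain ⟨r, hr, hball⟩ := Metric.eventually_nhds_iff_ball.1 hderiv
  have hconst : γ =ᶠ[nhds 0] fun _ => (1 : K) := by
    refine Metric.eventually_nhds_iff_ball.2 ⟨r, hr, fun t ht => ?_⟩
    rw [← hγ0]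
    exact hinj (Subtype.ext (Metric.isOpen_ball.is_const_of_fderiv_eq_zero
      (𝕜 := ℝ) (f := fun t => (ρ (γ t) : Mat N)) (convex_ball (0 : ℝ) r).isPreconnected
      (fun x hx => (hball x hx).differentiableAt.differentiableWithinAt)
      (fun x hx => by simpa using (hball x hx).hasFDerivAt.fderiv) ht (Metric.mem_ball_self hr)))
  have hvelocity := hasMFDerivAt_unique hγ.self_of_nhds
    ((hasMFDerivAt_const (I := 𝓘(ℝ, ℝ)) (I' := 𝓘(ℝ, E)) (1 : K) (0 : ℝ)).congr_of_eventuallyEq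
      hconst)
  have hfield : (1 : ℝ) • mulInvariantVectorField (I := 𝓘(ℝ, E)) (G := K) u (γ 0) = 0 :=
    congrArg (fun L => L (1 : ℝ)) hvelocity
  rwa [one_smul, hγ0, mulInvariantVectorField_apply_one] at hfield

theorem exists_hasDerivAt_rep_comp [CompleteSpace E] (u : E) :
    ∃ γ : ℝ → K, γ 0 = 1 ∧ HasDerivAt (fun t => (ρ (γ t) : Mat N)) (repDeriv ρ u) 0 := by
  obtain ⟨γ, hγ0, hγ⟩ := exists_isMIntegralCurveAt_mulInvariantVectorField (K := K) u
  refine ⟨γ, hγ0, ?_⟩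
  simpa [hγ0] using (hasDerivAt_rep_comp_of_isMIntegralCurveAt hρ hγ).self_of_nhds

theorem star_repDeriv [CompleteSpace E] (u : E) : star (repDeriv ρ u) = -repDeriv ρ u := by
  obtain ⟨γ, hγ0, hγ⟩ := exists_hasDerivAt_rep_comp hρ u
  have hunit : (fun t => (ρ (γ t) : Mat N)) * (fun t => star (ρ (γ t) : Mat N)) = fun _ => 1 := by
    ext1 t
    simp
  have hmul := hγ.mul hγ.star
  rw [hunit] at hmul
  have hzero := hmul.unique (hasDerivAt_const (0 : ℝ) (1 : Mat N))
  simp only [hγ0, map_one, OneMemClass.coe_one, star_one, one_mul, mul_one] at hzero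
  exact (neg_eq_of_add_eq_zero_right hzero).symm

theorem exists_hasDerivAt_repDeriv_adjointAction [CompleteSpace E] (Y : E) :
    ∃ γ : ℝ → K, γ 0 = 1 ∧ ∀ u : E, HasDerivAt (fun t => repDeriv ρ (adjointAction (γ t) u))
      ⁅repDeriv ρ Y, repDeriv ρ u⁆ 0 := by
  obtain ⟨γ, hγ0, hγ⟩ := exists_hasDerivAt_rep_comp hρ Y
  refine ⟨γ, hγ0, fun u => ?_⟩
  simp_rw [repDeriv_adjointAction hρ]
  refine ((hγ.mul_const (repDeriv ρ u)).mul hγ.star).congr_deriv ?_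
  rw [hγ0, map_one, OneMemClass.coe_one, star_one, one_mul, mul_one, star_repDeriv hρ,
    Ring.lie_def, sub_eq_add_neg]
  exact congrArg _ (mul_neg (repDeriv ρ u) (repDeriv ρ Y))

variable [FiniteDimensional ℝ E]

theorem lie_repDeriv_mem_range (Y u : E) :
    ∃ a : E, repDeriv ρ a = ⁅repDeriv ρ Y, repDeriv ρ u⁆ := by
  obtain ⟨γ, -, hγ⟩ := exists_hasDerivAt_repDeriv_adjointAction hρ Y
  have hclosed : IsClosed ((repDerivL (E := E) ρ).range : Set (Mat N)) :=
    Submodule.closed_of_finiteDimensional _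
  refine hclosed.mem_of_tendsto (hasDerivAt_iff_tendsto_slope.1 (hγ u))
    (Filter.Eventually.of_forall fun t => ?_)
  exact Submodule.smul_mem _ _ (Submodule.sub_mem _ ⟨_, rfl⟩ ⟨_, rfl⟩)

-- `ad Y` is skew, being the derivative of a curve of isometries.
theorem inner_add_inner_eq_zero_of_repDeriv_eq_lie (hAd : IsAdInvariant (E := E) K)
    (hinj : Function.Injective (repDeriv (E := E) ρ)) {Y u v a b : E}
    (ha : repDeriv ρ a = ⁅repDeriv ρ Y, repDeriv ρ u⁆)
    (hb : repDeriv ρ b = ⁅repDeriv ρ Y, repDeriv ρ v⁆) :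
    inner ℝ a v + inner ℝ u b = 0 := by
  obtain ⟨L, hL⟩ := (repDerivL (E := E) ρ).toLinearMap.exists_leftInverse_of_injective
    (LinearMap.ker_eq_bot.2 hinj)
  have hL_apply : ∀ w : E, L.toContinuousLinearMap (repDeriv ρ w) = w :=
    fun w => congrArg (fun f => f w) hL
  obtain ⟨γ, hγ0, hγ⟩ := exists_hasDerivAt_repDeriv_adjointAction hρ Y
  have hadjoint : ∀ {c w : E}, repDeriv ρ c = ⁅repDeriv ρ Y, repDeriv ρ w⁆ →
      HasDerivAt (fun t => adjointAction (γ t) w) c 0 := fun {c w} hc => by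
    have := L.toContinuousLinearMap.hasFDerivAt.comp_hasDerivAt (0 : ℝ) (hγ w)
    simp only [Function.comp_def, ← hc, hL_apply] at this
    exact this
  have hone : ∀ w : E, adjointAction (1 : K) w = w := fun w => hinj <| by
    simp [repDeriv_adjointAction hρ]
  have hinner := (hadjoint ha).inner ℝ (hadjoint hb)
  simp_rw [hAd (γ _) u v, hγ0, hone] at hinner
  rw [add_comm]
  exact hinner.unique (hasDerivAt_const (0 : ℝ) _)

end Representation

section LogarithmicDerivative

variable {N : ℕ}
  {E : Type*} [NormedAddCommGroup E] [InnerProductSpace ℝ E]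
  {K : Type*} [Group K] [TopologicalSpace K] [ChartedSpace E K]

open NormedSpace (exp)

/-- The exponent `i s dρ(Y)` of `ψ_s(x, Y) = ρ(x) e^{i s dρ(Y)}`, as a function of `Y`. -/
noncomputable def psiExponent (ρ : K →* unitary (Mat N)) (s : ℝ) : E →L[ℝ] Mat N :=
  (Complex.I * (s : ℂ)) • repDerivL ρ

theorem psiExponent_apply (ρ : K →* unitary (Mat N)) (s : ℝ) (Y : E) :
    psiExponent ρ s Y = (Complex.I * (s : ℂ)) • repDeriv ρ Y := rfl

theorem inverse_psi (ρ : K →* unitary (Mat N)) (s : ℝ) (x : K) (Y : E) :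
    Ring.inverse (psi ρ s (x, Y)) = exp (-psiExponent ρ s Y) * star (ρ x : Mat N) := by
  let _ : NormedAlgebra ℚ (Mat N) := NormedAlgebra.restrictScalars ℚ ℂ (Mat N)
  have hunit := NormedSpace.isUnit_exp (psiExponent ρ s Y)
  have hmul := Ring.inverse_unit (Unitary.toUnits (ρ x) * hunit.unit)
  rwa [mul_inv_rev, Units.val_mul, Units.val_mul, ← Ring.inverse_unit hunit.unit,
    hunit.unit_spec, Ring.inverse_exp] at hmul

theorem hasFDerivAt_exp_psiExponent (ρ : K →* unitary (Mat N)) (s : ℝ) (Y : E) :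
    HasFDerivAt (fun Y : E => exp (psiExponent ρ s Y))
      (((fderiv ℂ exp (psiExponent ρ s Y)).restrictScalars ℝ).comp (psiExponent ρ s)) Y :=
  ((hasFDerivAt_normedSpace_exp _).restrictScalars ℝ).comp Y (psiExponent ρ s).hasFDerivAt

variable {ρ : K →* unitary (Mat N)}
  (hρ : ContMDiff 𝓘(ℝ, E) 𝓘(ℝ, Mat N) ∞ fun x : K => (ρ x : Mat N))
include hρ

theorem mdifferentiableAt_psi (s : ℝ) (x : K) (Y : E) :
    MDifferentiableAt (𝓘(ℝ, E).prod 𝓘(ℝ, E)) 𝓘(ℝ, Mat N) (psi ρ s : K × E → Mat N) (x, Y) := by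
  have hfst : MDifferentiableAt (𝓘(ℝ, E).prod 𝓘(ℝ, E)) 𝓘(ℝ, Mat N)
      (fun q : K × E => (ρ q.1 : Mat N)) (x, Y) :=
    MDifferentiableAt.comp (x, Y) (g := fun x : K => (ρ x : Mat N)) (f := Prod.fst)
      (hasMFDerivAt_rep hρ x).mdifferentiableAt mdifferentiableAt_fst
  have hsnd : MDifferentiableAt (𝓘(ℝ, E).prod 𝓘(ℝ, E)) 𝓘(ℝ, Mat N)
      (fun q : K × E => exp (psiExponent ρ s q.2)) (x, Y) :=
    MDifferentiableAt.comp (x, Y) (g := fun Y : E => exp (psiExponent ρ s Y)) (f := Prod.snd)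
      (hasFDerivAt_exp_psiExponent ρ s Y).hasMFDerivAt.mdifferentiableAt mdifferentiableAt_snd
  exact hfst.mul hsnd

variable [LieGroup 𝓘(ℝ, E) ∞ K]

theorem dirDeriv_psi (s : ℝ) (x : K) (Y u a : E) :
    dirDeriv (psi ρ s) (x, Y) (u, a) =
      (ρ x : Mat N) * repDeriv ρ u * exp (psiExponent ρ s Y) +
        (ρ x : Mat N) * fderiv ℂ exp (psiExponent ρ s Y) (psiExponent ρ s a) := by
  have hfst : HasMFDerivAt 𝓘(ℝ, E) 𝓘(ℝ, Mat N) (fun z : K => psi ρ s (z, Y)) x _ :=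
    HasMFDerivAt.comp x
      ((ContinuousLinearMap.mul ℝ (Mat N)).flip (exp (psiExponent ρ s Y))).hasMFDerivAt
      (hasMFDerivAt_rep hρ x)
  have hsnd : HasMFDerivAt 𝓘(ℝ, E) 𝓘(ℝ, Mat N) (fun z : E => psi ρ s (x, z)) Y _ :=
    HasMFDerivAt.comp Y (ContinuousLinearMap.mul ℝ (Mat N) (ρ x : Mat N)).hasMFDerivAt
      (hasFDerivAt_exp_psiExponent ρ s Y).hasMFDerivAt
  refine (mfderiv_prod_eq_add_apply (mdifferentiableAt_psi hρ s x Y)).trans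
    (congrArg₂ (· + ·) ?_ (congrArg (fun L => L a) hsnd.mfderiv))
  refine (congrArg (fun L => L (mulInvariantVectorField (I := 𝓘(ℝ, E)) (G := K) u x))
    hfst.mfderiv).trans ?_
  exact congrArg (fun M : Mat N => M * exp (psiExponent ρ s Y))
    (mfderiv_rep_mulInvariantVectorField hρ x u)

theorem psiLogDeriv_eq (s : ℝ) (x : K) (Y u a : E) :
    psiLogDeriv ρ s (x, Y) (u, a) =
      exp (-psiExponent ρ s Y) * repDeriv ρ u * exp (psiExponent ρ s Y) +
      exp (-psiExponent ρ s Y) * fderiv ℂ exp (psiExponent ρ s Y) (psiExponent ρ s a) := by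
  have hcancel : ∀ M : Mat N, star (ρ x : Mat N) * ((ρ x : Mat N) * M) = M := fun M => by
    rw [← mul_assoc, Unitary.coe_star_mul_self, one_mul]
  rw [psiLogDeriv, dirDeriv_psi hρ, inverse_psi, mul_add]
  simp only [mul_assoc, hcancel]

end LogarithmicDerivative

section ComplexLieAlgebra

theorem eq_zero_and_eq_zero_of_add_I_smul_eq_zero {A : Type*} [AddCommGroup A] [Module ℂ A]
    [StarAddMonoid A] [StarModule ℂ A] {x y : A} (hx : star x = -x) (hy : star y = -y)
    (h : x + Complex.I • y = 0) : x = 0 ∧ y = 0 := by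
  have hstar : -x + Complex.I • y = 0 := by
    simpa [hx, hy] using congrArg star h
  have hy0 : y = 0 := by
    have : (2 : ℂ) • Complex.I • y = 0 := by
      rw [two_smul]
      calc _ = (x + Complex.I • y) + (-x + Complex.I • y) := by abel
        _ = 0 := by rw [h, hstar, add_zero]
    simpa using this
  exact ⟨by simpa [hy0] using h, hy0⟩

theorem trace_eq_zero_of_isHermitian_of_map_conj_eq_neg {ι : Type*} [Fintype ι]
    {A : Matrix ι ι ℂ} (hA : A.IsHermitian) (hconj : A.map (starRingEnd ℂ) = -A) :
    A.trace = 0 := by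
  have htranspose : A.transpose = -A := by
    rw [← hconj]
    ext i j
    simpa using (hA.apply j i).symm
  have htrace := A.trace_transpose
  rw [htranspose, Matrix.trace_neg] at htrace
  exact self_eq_neg.1 htrace.symm

theorem prod_exp_mul_eigenvalues_eq_one {ι : Type*} [Fintype ι] [DecidableEq ι]
    {A : Matrix ι ι ℂ} (hA : A.IsHermitian) (hconj : A.map (starRingEnd ℂ) = -A) (r : ℝ) :
    ∏ j, (Real.exp (r * hA.eigenvalues j) : ℂ) = 1 := by
  have hsum : ∑ j, hA.eigenvalues j = 0 := Complex.ofReal_injective <| by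
    rw [Complex.ofReal_sum, Complex.ofReal_zero,
      ← trace_eq_zero_of_isHermitian_of_map_conj_eq_neg hA hconj]
    exact hA.trace_eq_sum_eigenvalues.symm
  rw [← Complex.ofReal_prod, ← Real.exp_sum, ← Finset.mul_sum, hsum, mul_zero, Real.exp_zero,
    Complex.ofReal_one]

variable {ι : Type*} [Fintype ι] {N : ℕ}
  {E : Type*} [NormedAddCommGroup E] [InnerProductSpace ℝ E]
  {K : Type*} [Group K] [TopologicalSpace K] [ChartedSpace E K]
  (X : OrthonormalBasis ι ℝ E)

/-- The coordinates `c ↦ ∑ c_k dρ(X_k)` of the complexified Lie algebra. -/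
noncomputable def complexCoord (ρ : K →* unitary (Mat N)) : (ι → ℂ) →ₗ[ℂ] Mat N :=
  Fintype.linearCombination ℂ fun k => repDeriv ρ (X k)

/-- `A` is the matrix of `i ad Y` in the coordinates of the complexified Lie algebra. -/
def IsAdMatrix (ρ : K →* unitary (Mat N)) (Y : E) (A : Matrix ι ι ℂ) : Prop :=
  ∀ c, Complex.I • ⁅repDeriv ρ Y, complexCoord X ρ c⁆ = complexCoord X ρ (A.mulVec c)

theorem complexCoord_apply (ρ : K →* unitary (Mat N)) (c : ι → ℂ) :
    complexCoord X ρ c = ∑ k, c k • repDeriv ρ (X k) := rfl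

theorem complexCoord_single [DecidableEq ι] (ρ : K →* unitary (Mat N)) (j : ι) :
    complexCoord X ρ (Pi.single j 1) = repDeriv ρ (X j) :=
  (Fintype.linearCombination_apply_single ℂ (fun k => repDeriv ρ (X k)) j 1).trans (one_smul ℂ _)

theorem complexCoord_ofReal (ρ : K →* unitary (Mat N)) (c : ι → ℝ) :
    complexCoord X ρ (fun k => (c k : ℂ)) = repDeriv ρ (∑ k, c k • X k) := by
  rw [complexCoord_apply, ← repDerivL_apply, map_sum]
  refine Finset.sum_congr rfl fun k _ => ?_
  rw [map_smul, repDerivL_apply]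
  exact algebraMap_smul ℂ (c k) (repDeriv ρ (X k) : Mat N)

theorem complexCoord_inner (ρ : K →* unitary (Mat N)) (u : E) :
    complexCoord X ρ (fun k => ((inner ℝ (X k) u : ℝ) : ℂ)) = repDeriv ρ u := by
  rw [complexCoord_ofReal, X.sum_repr']

variable [LieGroup 𝓘(ℝ, E) ∞ K] {ρ : K →* unitary (Mat N)}
  (hinj : Function.Injective (repDeriv (E := E) ρ))
  (hρ : ContMDiff 𝓘(ℝ, E) 𝓘(ℝ, Mat N) ∞ fun x : K => (ρ x : Mat N))
include hinj hρ

-- The image of `repDeriv ρ` is totally real, since it consists of skew-adjoint matrices.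
theorem complexCoord_injective [CompleteSpace E] : Function.Injective (complexCoord X ρ) := by
  refine (injective_iff_map_eq_zero _).2 fun c hc => ?_
  have hsplit : complexCoord X ρ c = repDeriv ρ (∑ k, (c k).re • X k) +
      Complex.I • repDeriv ρ (∑ k, (c k).im • X k) := by
    rw [← complexCoord_ofReal, ← complexCoord_ofReal, ← map_smul, ← map_add]
    congr 1
    ext k
    simp [mul_comm Complex.I]
  obtain ⟨hre, him⟩ := eq_zero_and_eq_zero_of_add_I_smul_eq_zero (star_repDeriv hρ _)
    (star_repDeriv hρ _) (hsplit.symm.trans hc)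
  have hcoord : ∀ d : ι → ℝ, repDeriv ρ (∑ k, d k • X k) = 0 → ∀ k, d k = 0 := fun d hd =>
    Fintype.linearIndependent_iff.1 X.orthonormal.linearIndependent d
      ((injective_iff_map_eq_zero (repDerivL ρ)).1 hinj _ hd)
  ext k
  exact Complex.ext (hcoord _ hre k) (hcoord _ him k)

theorem exists_isAdMatrix [FiniteDimensional ℝ E] (hAd : IsAdInvariant (E := E) K) (Y : E) :
    ∃ A : Matrix ι ι ℂ, A.IsHermitian ∧ A.map (starRingEnd ℂ) = -A ∧ IsAdMatrix X ρ Y A := by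
  choose B hB using lie_repDeriv_mem_range hρ Y
  have hskew : ∀ j k, inner ℝ (X k) (B (X j)) = -inner ℝ (X j) (B (X k)) := fun j k => by
    have := inner_add_inner_eq_zero_of_repDeriv_eq_lie hρ hAd hinj (hB (X j)) (hB (X k))
    rw [real_inner_comm] at this
    linarith
  refine ⟨Matrix.of fun j k => Complex.I * ((inner ℝ (X j) (B (X k)) : ℝ) : ℂ), ?_, ?_, ?_⟩
  · ext j k
    simp [hskew k j]
  · ext j k
    simp
  · intro c
    have hmulVec : (Matrix.of fun j k => Complex.I * ((inner ℝ (X j) (B (X k)) : ℝ) : ℂ)).mulVec c =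
        Complex.I • ∑ k, c k • fun j => ((inner ℝ (X j) (B (X k)) : ℝ) : ℂ) := by
      ext j
      simp [Matrix.mulVec, dotProduct, Finset.mul_sum, mul_assoc, mul_comm (c _)]
    rw [hmulVec, map_smul, map_sum, complexCoord_apply, Ring.lie_def, Finset.mul_sum,
      Finset.sum_mul, ← Finset.sum_sub_distrib]
    congr 1
    refine Finset.sum_congr rfl fun k _ => ?_
    rw [map_smul, complexCoord_inner, hB, Ring.lie_def, mul_smul_comm, smul_mul_assoc, smul_sub]

end ComplexLieAlgebra

section EigenAction

variable {ι : Type*} [Fintype ι]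

/-- `F` acts on every eigenvector of `A` with real eigenvalue `l` as multiplication by `f l`. For a
Hermitian matrix `A` this says that `F = f(A)`. -/
def EigenAction (A F : Matrix ι ι ℂ) (f : ℝ → ℂ) : Prop :=
  ∀ (l : ℝ) (v : ι → ℂ), A.mulVec v = (l : ℂ) • v → F.mulVec v = f l • v

theorem EigenAction.conj {A F : Matrix ι ι ℂ} {f : ℝ → ℂ} (h : EigenAction A F f)
    (hA : A.map (starRingEnd ℂ) = -A) :
    EigenAction A (F.map (starRingEnd ℂ)) fun l => starRingEnd ℂ (f (-l)) := by
  intro l v hv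
  have hstar : A.mulVec (star v) = ((-l : ℝ) : ℂ) • star v := by
    rw [← neg_eq_iff_eq_neg.2 hA, Matrix.neg_mulVec, Complex.ofReal_neg, neg_smul, neg_inj]
    ext i
    simpa [Matrix.mulVec, dotProduct] using congrArg (starRingEnd ℂ) (congrFun hv i)
  ext i
  simpa [Matrix.mulVec, dotProduct] using congrArg (starRingEnd ℂ) (congrFun (h _ _ hstar) i)

theorem exists_eigenAction {V : Type*} [AddCommGroup V] [Module ℂ V]
    {A : Matrix ι ι ℂ} (hA : A.IsHermitian) {S : (ι → ℂ) →ₗ[ℂ] V} (hS : Function.Injective S)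
    (Φ : V →ₗ[ℂ] V) (f : ℝ → ℂ)
    (h : ∀ (l : ℝ) (v : ι → ℂ), A.mulVec v = (l : ℂ) • v → Φ (S v) = f l • S v) :
    ∃ F, EigenAction A F f ∧ ∀ c, Φ (S c) = S (F.mulVec c) := by
  classical
  obtain ⟨L, hL⟩ := S.exists_leftInverse_of_injective (LinearMap.ker_eq_bot.2 hS)
  have hL_apply : ∀ c, L (S c) = c := fun c => congrArg (fun g => g c) hL
  refine ⟨LinearMap.toMatrix' (L ∘ₗ Φ ∘ₗ S), fun l v hv => ?_, fun c => ?_⟩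
  · rw [LinearMap.toMatrix'_mulVec, LinearMap.comp_apply, LinearMap.comp_apply, h l v hv, map_smul,
      hL_apply]
  · have hlin : Φ ∘ₗ S = S ∘ₗ (L ∘ₗ Φ ∘ₗ S) := by
      refine (hA.eigenvectorBasis.toBasis.map (WithLp.linearEquiv 2 ℂ (ι → ℂ))).ext fun j => ?_
      have hj := h _ _ (hA.mulVec_eigenvectorBasis j)
      have hbasis : hA.eigenvectorBasis.toBasis.map (WithLp.linearEquiv 2 ℂ (ι → ℂ)) j =
          (hA.eigenvectorBasis j : ι → ℂ) := by simp
      rw [hbasis]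
      simp only [LinearMap.comp_apply]
      rw [hj, map_smul, map_smul, hL_apply]
    rw [LinearMap.toMatrix'_mulVec]
    exact congrArg (fun g => g c) hlin

variable [DecidableEq ι]

theorem EigenAction.mul_eigenvectorUnitary {A F : Matrix ι ι ℂ} {f : ℝ → ℂ}
    (h : EigenAction A F f) (hA : A.IsHermitian) :
    F * (hA.eigenvectorUnitary : Matrix ι ι ℂ) =
      (hA.eigenvectorUnitary : Matrix ι ι ℂ) *
        Matrix.diagonal fun j => f (hA.eigenvalues j) := by
  ext i j
  rw [Matrix.mul_diagonal, mul_comm, hA.eigenvectorUnitary_apply]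
  exact congrFun (h (hA.eigenvalues j) _ (hA.mulVec_eigenvectorBasis j)) i

theorem det_fromBlocks_diagonal {R : Type*} [CommRing R] (a b c d : ι → R) :
    (Matrix.fromBlocks (Matrix.diagonal a) (Matrix.diagonal b) (Matrix.diagonal c)
      (Matrix.diagonal d)).det = ∏ i, (a i * d i - b i * c i) := by
  have hblocks : Matrix.fromBlocks (Matrix.diagonal a) (Matrix.diagonal b) (Matrix.diagonal c)
      (Matrix.diagonal d) = (Matrix.blockDiagonal fun i => !![a i, b i; c i, d i]).submatrix
        ((matchedPairs ι).symm.trans (Equiv.prodComm ι (Fin 2)))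
        ((matchedPairs ι).symm.trans (Equiv.prodComm ι (Fin 2))) := by
    ext (i | i) (j | j) <;>
      simp [matchedPairs, Matrix.blockDiagonal_apply, Matrix.diagonal_apply]
  rw [hblocks, Matrix.det_submatrix_equiv_self, Matrix.det_blockDiagonal]
  simp only [Matrix.det_fin_two_of]

theorem EigenAction.det_fromBlocks {A F₁ F₂ F₃ F₄ : Matrix ι ι ℂ} {f₁ f₂ f₃ f₄ : ℝ → ℂ}
    (hA : A.IsHermitian) (h₁ : EigenAction A F₁ f₁) (h₂ : EigenAction A F₂ f₂)
    (h₃ : EigenAction A F₃ f₃) (h₄ : EigenAction A F₄ f₄) :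
    (Matrix.fromBlocks F₁ F₂ F₃ F₄).det = ∏ j, (f₁ (hA.eigenvalues j) * f₄ (hA.eigenvalues j) -
      f₂ (hA.eigenvalues j) * f₃ (hA.eigenvalues j)) := by
  set U : Matrix ι ι ℂ := (hA.eigenvectorUnitary : Matrix ι ι ℂ)
  have hdetU : U.det ≠ 0 := right_ne_zero_of_mul_eq_one (a := (star U).det) <| by
    rw [← Matrix.det_mul, Unitary.coe_star_mul_self, Matrix.det_one]
  have hdet : (Matrix.fromBlocks U 0 0 U).det ≠ 0 := by
    rw [Matrix.det_fromBlocks_zero₂₁]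
    exact mul_ne_zero hdetU hdetU
  have hdiag : Matrix.fromBlocks F₁ F₂ F₃ F₄ * Matrix.fromBlocks U 0 0 U =
      Matrix.fromBlocks U 0 0 U * Matrix.fromBlocks
        (Matrix.diagonal fun j => f₁ (hA.eigenvalues j))
        (Matrix.diagonal fun j => f₂ (hA.eigenvalues j))
        (Matrix.diagonal fun j => f₃ (hA.eigenvalues j))
        (Matrix.diagonal fun j => f₄ (hA.eigenvalues j)) := by
    simp only [Matrix.fromBlocks_multiply, Matrix.mul_zero, Matrix.zero_mul, add_zero, zero_add]
    rw [h₁.mul_eigenvectorUnitary hA, h₂.mul_eigenvectorUnitary hA, h₃.mul_eigenvectorUnitary hA,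
      h₄.mul_eigenvectorUnitary hA]
  have := congrArg Matrix.det hdiag
  rw [Matrix.det_mul, Matrix.det_mul, mul_comm] at this
  rw [mul_left_cancel₀ hdet this, det_fromBlocks_diagonal]

end EigenAction

section OmegaRatio

variable {n N : ℕ}
  {E : Type*} [NormedAddCommGroup E] [InnerProductSpace ℝ E]
  {K : Type*} [Group K] [TopologicalSpace K] [ChartedSpace E K]
  {X : OrthonormalBasis (Fin n) ℝ E} {ρ : K →* unitary (Mat N)}

open NormedSpace (exp)

theorem holForm_eq (hS : Function.Injective (complexCoord X ρ)) {s : ℝ} {p : K × E} {t : E × E}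
    {c : Fin n → ℂ} (h : psiLogDeriv ρ s p t = complexCoord X ρ c) (k : Fin n) :
    holForm X ρ s p k t = c k := by
  rw [holForm, h]
  exact congrFun (Function.leftInverse_invFun hS c) k

theorem IsAdMatrix.lie_psiExponent_eq_smul {Y : E} {A : Matrix (Fin n) (Fin n) ℂ}
    (had : IsAdMatrix X ρ Y A) (s : ℝ) {l : ℝ} {v : Fin n → ℂ} (hv : A.mulVec v = (l : ℂ) • v) :
    ⁅psiExponent ρ s Y, complexCoord X ρ v⁆ = ((s * l : ℝ) : ℂ) • complexCoord X ρ v := by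
  have hsmul : ⁅psiExponent ρ s Y, complexCoord X ρ v⁆ =
      (s : ℂ) • Complex.I • ⁅repDeriv ρ Y, complexCoord X ρ v⁆ := by
    rw [psiExponent_apply, mul_comm, mul_smul]
    simp only [Ring.lie_def, smul_mul_assoc, mul_smul_comm, smul_sub]
  rw [hsmul, had v, hv, map_smul, smul_smul, Complex.ofReal_mul]

variable [LieGroup 𝓘(ℝ, E) ∞ K]

section Frame

variable (hρ : ContMDiff 𝓘(ℝ, E) 𝓘(ℝ, Mat N) ∞ fun x : K => (ρ x : Mat N))
  (hS : Function.Injective (complexCoord X ρ))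
  {Y : E} {A : Matrix (Fin n) (Fin n) ℂ} (hA : A.IsHermitian) (had : IsAdMatrix X ρ Y A)
include hρ

theorem psiLogDeriv_fst (s : ℝ) (x : K) (Y u : E) :
    psiLogDeriv ρ s (x, Y) (u, 0) =
      exp (-psiExponent ρ s Y) * repDeriv ρ u * exp (psiExponent ρ s Y) := by
  rw [psiLogDeriv_eq hρ, map_zero, map_zero, mul_zero, add_zero]

theorem psiLogDeriv_snd (s : ℝ) (x : K) (Y a : E) :
    psiLogDeriv ρ s (x, Y) (0, a) =
      exp (-psiExponent ρ s Y) * fderiv ℂ exp (psiExponent ρ s Y) (psiExponent ρ s a) := by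
  rw [psiLogDeriv_eq hρ, ← repDerivL_apply, map_zero, mul_zero, zero_mul, zero_add]

include hS hA had

theorem exists_eigenAction_psiLogDeriv_fst (s : ℝ) :
    ∃ P, EigenAction A P (fun l => (Real.exp (-(s * l)) : ℂ)) ∧
      ∀ x j, psiLogDeriv ρ s (x, Y) (X j, 0) = complexCoord X ρ (P.col j) := by
  obtain ⟨P, hP, hP'⟩ := exists_eigenAction hA hS
    (LinearMap.mulRight ℂ (exp (psiExponent ρ s Y)) ∘ₗ
      LinearMap.mulLeft ℂ (exp (-psiExponent ρ s Y)))
    (fun l => (Real.exp (-(s * l)) : ℂ))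
    (fun l v hv => (exp_neg_mul_mul_exp_of_lie_eq_smul
      (had.lie_psiExponent_eq_smul s hv)).trans (by push_cast; rfl))
  refine ⟨P, hP, fun x j => ?_⟩
  rw [psiLogDeriv_fst hρ, ← complexCoord_single, ← Matrix.mulVec_single_one, ← hP']
  rfl

theorem exists_eigenAction_psiLogDeriv_snd (s : ℝ) :
    ∃ Q, EigenAction A Q (fun l => Complex.I * expQuot s l) ∧
      ∀ x j, psiLogDeriv ρ s (x, Y) (0, X j) = complexCoord X ρ (Q.col j) := by
  obtain ⟨Q, hQ, hQ'⟩ := exists_eigenAction hA hS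
    (LinearMap.mulLeft ℂ (exp (-psiExponent ρ s Y)) ∘ₗ
      (fderiv ℂ exp (psiExponent ρ s Y) : Mat N →ₗ[ℂ] Mat N) ∘ₗ
      ((Complex.I * (s : ℂ)) • LinearMap.id))
    (fun l => Complex.I * expQuot s l)
    (fun l v hv => by
      change exp (-psiExponent ρ s Y) * fderiv ℂ exp (psiExponent ρ s Y)
        ((Complex.I * (s : ℂ)) • complexCoord X ρ v) = _
      rw [mul_smul, map_smul, mul_smul_comm, exp_neg_mul_fderiv_exp_smul_of_lie_eq_smul
        (had.lie_psiExponent_eq_smul s hv), smul_smul])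
  refine ⟨Q, hQ, fun x j => ?_⟩
  rw [psiLogDeriv_snd hρ, psiExponent_apply ρ s (X j), ← complexCoord_single,
    ← Matrix.mulVec_single_one, ← hQ']
  rfl

theorem OmegaBarWedgeOmega_cotangentFrame (hconj : A.map (starRingEnd ℂ) = -A) (x : K)
    (s s' : ℝ) :
    OmegaBarWedgeOmega X ρ s s' (x, Y) (cotangentFrame X) =
      (2 * Complex.I) ^ n * ∏ j, (sinhQuot ((s + s') / 2) (hA.eigenvalues j) : ℂ) := by
  obtain ⟨P, hP, hPX⟩ := exists_eigenAction_psiLogDeriv_fst hρ hS hA had s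
  obtain ⟨Q, hQ, hQX⟩ := exists_eigenAction_psiLogDeriv_snd hρ hS hA had s
  obtain ⟨P', hP', hPX'⟩ := exists_eigenAction_psiLogDeriv_fst hρ hS hA had s'
  obtain ⟨Q', hQ', hQX'⟩ := exists_eigenAction_psiLogDeriv_snd hρ hS hA had s'
  have hdet : OmegaBarWedgeOmega X ρ s s' (x, Y) (cotangentFrame X) =
      (Matrix.fromBlocks (P.map (starRingEnd ℂ)) (Q.map (starRingEnd ℂ)) P' Q').det := by
    unfold OmegaBarWedgeOmega wedge
    congr 1
    ext (i | i) (j | j)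
    · exact congrArg (starRingEnd ℂ) (holForm_eq hS (hPX x j) i)
    · exact congrArg (starRingEnd ℂ) (holForm_eq hS (hQX x j) i)
    · exact holForm_eq hS (hPX' x j) i
    · exact holForm_eq hS (hQX' x j) i
  have hblock : ∀ l : ℝ, starRingEnd ℂ (Real.exp (-(s * -l)) : ℂ) * (Complex.I * expQuot s' l) -
      starRingEnd ℂ (Complex.I * expQuot s (-l)) * (Real.exp (-(s' * l)) : ℂ) =
      2 * Complex.I * (Real.exp ((s - s') / 2 * l) * sinhQuot ((s + s') / 2) l : ℂ) := fun l => by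
    have := congrArg Complex.ofReal (exp_mul_expQuot_add_exp_mul_expQuot s s' l)
    simp only [map_mul, Complex.conj_I, Complex.conj_ofReal, mul_neg, neg_neg]
    push_cast at this ⊢
    linear_combination Complex.I * this
  -- The exponential factors cancel since `ad Y` is traceless.
  rw [hdet, EigenAction.det_fromBlocks hA (hP.conj hconj) (hQ.conj hconj) hP' hQ',
    Finset.prod_congr rfl fun j _ => hblock _, Finset.prod_mul_distrib, Finset.prod_const,
    Finset.card_univ, Fintype.card_fin, Finset.prod_mul_distrib,
    prod_exp_mul_eigenvalues_eq_one hA hconj, one_mul]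

theorem OmegaRatio_eq_prod_sinhQuot (hconj : A.map (starRingEnd ℂ) = -A) (x : K) (s s' : ℝ) :
    OmegaRatio X ρ s s' (x, Y) =
      ((∏ j, sinhQuot ((s + s') / 2) (hA.eigenvalues j) : ℝ) : ℂ) := by
  have hsign : ((-1 : ℂ) ^ (n * (n - 1) / 2)) * (-1) ^ (n * (n - 1) / 2) = 1 := by
    rw [← mul_pow]; simp
  rw [OmegaRatio, OmegaBarWedgeOmega_cotangentFrame hρ hS hA had hconj,
    liouvilleForm_cotangentFrame]
  push_cast
  rw [mul_assoc, hsign, mul_one]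
  exact mul_div_cancel_left₀ _ (pow_ne_zero _ (by simp))

end Frame

variable [FiniteDimensional ℝ E] (hAd : IsAdInvariant (E := E) K) (X)
  (hinj : Function.Injective (repDeriv (E := E) ρ))
  (hρ : ContMDiff 𝓘(ℝ, E) 𝓘(ℝ, Mat N) ∞ fun x : K => (ρ x : Mat N))
include hAd hinj hρ

theorem exists_OmegaRatio_eq (Y : E) :
    ∃ l : Fin n → ℝ, ∀ (x : K) (s s' : ℝ),
      OmegaRatio X ρ s s' (x, Y) = ((∏ j, sinhQuot ((s + s') / 2) (l j) : ℝ) : ℂ) := by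
  obtain ⟨A, hA, hconj, had⟩ := exists_isAdMatrix X hinj hρ hAd Y
  exact ⟨hA.eigenvalues,
    OmegaRatio_eq_prod_sinhQuot hρ (complexCoord_injective X hinj hρ) hA had hconj⟩

theorem psiLogDeriv_cotangentFrame_mem_range (s : ℝ) (p : K × E) (k : Fin n ⊕ Fin n) :
    psiLogDeriv ρ s p (cotangentFrame X k) ∈ Set.range (complexCoord X ρ) := by
  obtain ⟨A, hA, -, had⟩ := exists_isAdMatrix X hinj hρ hAd p.2
  have hS := complexCoord_injective X hinj hρ
  rcases k with j | j
  · obtain ⟨P, -, hP⟩ := exists_eigenAction_psiLogDeriv_fst hρ hS hA had s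
    exact ⟨P.col j, (hP p.1 j).symm⟩
  · obtain ⟨Q, -, hQ⟩ := exists_eigenAction_psiLogDeriv_snd hρ hS hA had s
    exact ⟨Q.col j, (hQ p.1 j).symm⟩

omit hAd hinj [FiniteDimensional ℝ E] in
theorem continuous_psiLogDeriv (s : ℝ) (x : K) (t : E × E) :
    Continuous fun Y : E => psiLogDeriv ρ s (x, Y) t := by
  let _ : NormedAlgebra ℚ (Mat N) := NormedAlgebra.restrictScalars ℚ ℂ (Mat N)
  have hexp : Continuous fun Y : E => exp (psiExponent ρ s Y) :=
    NormedSpace.exp_continuous.comp (psiExponent ρ s).continuous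
  have hexp_neg : Continuous fun Y : E => exp (-psiExponent ρ s Y) :=
    NormedSpace.exp_continuous.comp (psiExponent ρ s).continuous.neg
  have hfderiv : Continuous fun Y : E => fderiv ℂ exp (psiExponent ρ s Y) :=
    (contDiff_normedSpace_exp.continuous_fderiv (by simp)).comp (psiExponent ρ s).continuous
  simp only [psiLogDeriv_eq hρ s x _ t.1 t.2]
  exact ((hexp_neg.mul continuous_const).mul hexp).add
    (hexp_neg.mul (hfderiv.clm_apply continuous_const))

theorem continuous_holForm_cotangentFrame (s : ℝ) (x : K) (i : Fin n) (k : Fin n ⊕ Fin n) :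
    Continuous fun Y : E => holForm X ρ s (x, Y) i (cotangentFrame X k) := by
  have hS := complexCoord_injective X hinj hρ
  obtain ⟨L, hL⟩ := (complexCoord X ρ).exists_leftInverse_of_injective (LinearMap.ker_eq_bot.2 hS)
  have hform : ∀ Y, holForm X ρ s (x, Y) i (cotangentFrame X k) =
      L (psiLogDeriv ρ s (x, Y) (cotangentFrame X k)) i := fun Y => by
    obtain ⟨c, hc⟩ := psiLogDeriv_cotangentFrame_mem_range X hAd hinj hρ s (x, Y) k
    rw [holForm_eq hS hc.symm, ← hc]
    exact (congrFun (LinearMap.congr_fun hL c) i).symm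
  simp only [hform]
  exact (continuous_apply i).comp
    (L.continuous_of_finiteDimensional.comp (continuous_psiLogDeriv hρ s x _))

theorem continuous_OmegaRatio (s s' : ℝ) (x : K) :
    Continuous fun Y : E => OmegaRatio X ρ s s' (x, Y) := by
  unfold OmegaRatio OmegaBarWedgeOmega wedge
  simp only [liouvilleForm_cotangentFrame]
  refine Continuous.div_const (Continuous.matrix_det (continuous_matrix fun i k => ?_)) _
  rcases i with i | i
  · exact Complex.continuous_conj.comp
      (continuous_holForm_cotangentFrame X hAd hinj hρ s x i k)
  · exact continuous_holForm_cotangentFrame X hAd hinj hρ s' x i k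

theorem measurable_OmegaRatio [MeasurableSpace E] [BorelSpace E] [MeasurableSpace K] (s s' : ℝ) :
    Measurable fun p : K × E => OmegaRatio X ρ s s' p := by
  have hsnd : (fun p : K × E => OmegaRatio X ρ s s' p) =
      (fun Y : E => OmegaRatio X ρ s s' ((1 : K), Y)) ∘ Prod.snd := by
    ext1 ⟨x, Y⟩
    obtain ⟨l, hl⟩ := exists_OmegaRatio_eq X hAd hinj hρ Y
    simp only [Function.comp_apply, hl]
  rw [hsnd]
  exact (continuous_OmegaRatio X hAd hinj hρ s s' 1).measurable.comp measurable_snd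

end OmegaRatio

section WeightedL2

variable {α : Type*} [MeasurableSpace α] {ν : Measure α}

theorem ae_withDensity_ofReal {w : α → ℝ} (hw : Measurable w) (hpos : ∀ p, 0 < w p) :
    ae (ν.withDensity fun p => ENNReal.ofReal (w p)) = ae ν :=
  le_antisymm (withDensity_absolutelyContinuous ν _).ae_le
    (withDensity_absolutelyContinuous' hw.ennreal_ofReal.aemeasurable
      (Filter.Eventually.of_forall fun p => (ENNReal.ofReal_pos.2 (hpos p)).ne')).ae_le

theorem memLp_two_withDensity_iff {F : Type*} [NormedAddCommGroup F] [NormedSpace ℝ F]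
    {w : α → ℝ} (hw : Measurable w) (hpos : ∀ p, 0 < w p) {f : α → F} :
    MemLp f 2 (ν.withDensity fun p => ENNReal.ofReal (w p)) ↔
      MemLp (fun p => √(w p) • f p) 2 ν := by
  have hae := ae_withDensity_ofReal (ν := ν) hw hpos
  have hcancel : ∀ p, (√(w p))⁻¹ • √(w p) • f p = f p := fun p =>
    inv_smul_smul₀ (Real.sqrt_pos.2 (hpos p)).ne' _
  have hmeas : AEStronglyMeasurable f (ν.withDensity fun p => ENNReal.ofReal (w p)) ↔
      AEStronglyMeasurable (fun p => √(w p) • f p) ν := by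
    refine ⟨fun h => hw.sqrt.aestronglyMeasurable.smul
      (h.mono_ac (Measure.ae_le_iff_absolutelyContinuous.1 hae.ge)), fun h => ?_⟩
    have hinv := hw.sqrt.inv.aestronglyMeasurable.smul h
    simp only [Pi.smul_def', Pi.inv_apply, hcancel] at hinv
    exact hinv.mono_ac (Measure.ae_le_iff_absolutelyContinuous.1 hae.le)
  by_cases h : AEStronglyMeasurable f (ν.withDensity fun p => ENNReal.ofReal (w p))
  · rw [memLp_two_iff_integrable_sq_norm h, memLp_two_iff_integrable_sq_norm (hmeas.1 h),
      integrable_withDensity_iff_integrable_smul' hw.ennreal_ofReal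
        (Filter.Eventually.of_forall fun p => ENNReal.ofReal_lt_top)]
    refine integrable_congr (Filter.Eventually.of_forall fun p => ?_)
    simp only [smul_eq_mul, norm_smul, Real.norm_eq_abs, mul_pow, sq_abs]
    rw [ENNReal.toReal_ofReal (hpos p).le, Real.sq_sqrt (hpos p).le]
  · exact ⟨fun h' => absurd h'.1 h, fun h' => absurd (hmeas.2 h'.1) h⟩

variable {𝕜 : Type*} [RCLike 𝕜]

theorem norm_integral_mul_kernel_sub_inner_le (g g' : Lp 𝕜 2 ν) {κ : α → 𝕜}
    (hκ : AEStronglyMeasurable κ ν) {c : ℝ} (hc : ∀ᵐ p ∂ν, ‖κ p - 1‖ ≤ c) :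
    ‖(∫ p, starRingEnd 𝕜 (g p) * g' p * κ p ∂ν) - inner 𝕜 g g'‖ ≤ c * (‖g‖ * ‖g'‖) := by
  have hbound : ∀ᵐ p ∂ν, ‖(κ p - 1) * g' p‖ ≤ c * ‖g' p‖ := hc.mono fun p hp => by
    rw [norm_mul]
    exact mul_le_mul_of_nonneg_right hp (norm_nonneg _)
  have hL : MemLp (fun p => (κ p - 1) * g' p) 2 ν :=
    (Lp.memLp g').of_le_mul ((hκ.sub aestronglyMeasurable_const).mul (Lp.aestronglyMeasurable g'))
      hbound
  set h := hL.toLp _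
  have hh : ‖h‖ ≤ c * ‖g'‖ := by
    refine Lp.norm_le_mul_norm_of_ae_le_mul ?_
    filter_upwards [hL.coeFn_toLp, hbound] with p hp hp'
    rwa [hp]
  have heq : ∫ p, starRingEnd 𝕜 (g p) * g' p * κ p ∂ν = inner 𝕜 g (g' + h) := by
    rw [L2.inner_def]
    refine integral_congr_ae ?_
    filter_upwards [hL.coeFn_toLp, Lp.coeFn_add g' h] with p hp hp'
    rw [hp', Pi.add_apply, hp, RCLike.inner_apply]
    ring
  rw [heq, inner_add_right, add_sub_cancel_left]
  calc ‖inner 𝕜 g h‖ ≤ ‖g‖ * ‖h‖ := norm_inner_le_norm _ _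
    _ ≤ ‖g‖ * (c * ‖g'‖) := by gcongr
    _ = c * (‖g‖ * ‖g'‖) := by ring

theorem eq_starProjection_iff_mem_and_inner_eq {V : Type*} [NormedAddCommGroup V]
    [InnerProductSpace 𝕜 V] {H : Submodule 𝕜 V} [H.HasOrthogonalProjection] {D v : V} :
    D = H.starProjection v ↔ D ∈ H ∧ ∀ τ ∈ H, inner 𝕜 τ D = inner 𝕜 τ v := by
  constructor
  · rintro rfl
    refine ⟨H.starProjection_apply_mem v, fun τ hτ => ?_⟩
    rw [← Submodule.inner_starProjection_left_eq_right, Submodule.starProjection_eq_self_iff.2 hτ]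
  · rintro ⟨hD, h⟩
    refine (Submodule.eq_starProjection_of_mem_of_inner_eq_zero hD fun τ hτ => ?_).symm
    rw [inner_eq_zero_symm, inner_sub_right, h τ hτ, sub_self]

end WeightedL2

section Connections

variable {n N : ℕ}
  {E : Type*} [NormedAddCommGroup E] [InnerProductSpace ℝ E]
  {K : Type*} [Group K] [TopologicalSpace K] [ChartedSpace E K]
  (X : OrthonormalBasis (Fin n) ℝ E) (ρ : K →* unitary (Mat N))

/-- The kernel `√((conj Ω_s ∧ Ω_s') / (b ε)) / √(|Ω_s| |Ω_s'|)` of the BKS pairing of two functions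
in the global trivialization of the prequantum bundle. -/
noncomputable def bksKernel (s s' : ℝ) (p : K × E) : ℝ :=
  √(OmegaRatio X ρ s s' p).re / (√(OmegaNorm X ρ s p) * √(OmegaNorm X ρ s' p))

variable [FiniteDimensional ℝ E] [LieGroup 𝓘(ℝ, E) ∞ K] {ρ}
  (hAd : IsAdInvariant (E := E) K) (hinj : Function.Injective (repDeriv (E := E) ρ))
  (hρ : ContMDiff 𝓘(ℝ, E) 𝓘(ℝ, Mat N) ∞ fun x : K => (ρ x : Mat N))
  {s s' : ℝ}
include hAd hinj hρ

theorem exists_OmegaRatio_eq_and_OmegaNorm_eq (p : K × E) :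
    ∃ l : Fin n → ℝ, (∀ s s' : ℝ,
      OmegaRatio X ρ s s' p = ((∏ j, sinhQuot ((s + s') / 2) (l j) : ℝ) : ℂ)) ∧
      ∀ s : ℝ, OmegaNorm X ρ s p = √(∏ j, sinhQuot s (l j)) := by
  obtain ⟨l, hl⟩ := exists_OmegaRatio_eq X hAd hinj hρ p.2
  refine ⟨l, hl p.1, fun s => ?_⟩
  rw [OmegaNorm, hl p.1 s s, Complex.ofReal_re, add_self_div_two]

theorem OmegaNorm_pos (hs : 0 < s) (p : K × E) : 0 < OmegaNorm X ρ s p := by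
  obtain ⟨l, -, hl⟩ := exists_OmegaRatio_eq_and_OmegaNorm_eq X hAd hinj hρ p
  rw [hl]
  exact Real.sqrt_pos.2 (Finset.prod_pos fun j _ => sinhQuot_pos hs _)

theorem ofReal_sqrt_OmegaNorm_ne_zero (hs : 0 < s) (p : K × E) :
    ((√(OmegaNorm X ρ s p) : ℝ) : ℂ) ≠ 0 :=
  Complex.ofReal_ne_zero.2 (Real.sqrt_pos.2 (OmegaNorm_pos X hAd hinj hρ hs p)).ne'

theorem OmegaRatio_cpow_half (hs : 0 < s) (hs' : 0 < s') (p : K × E) :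
    OmegaRatio X ρ s s' p ^ (1 / 2 : ℂ) = ((√(OmegaRatio X ρ s s' p).re : ℝ) : ℂ) := by
  obtain ⟨l, hl⟩ := exists_OmegaRatio_eq X hAd hinj hρ p.2
  have hpos : 0 ≤ ∏ j, sinhQuot ((s + s') / 2) (l j) :=
    Finset.prod_nonneg fun j _ => (sinhQuot_pos (by linarith) _).le
  rw [hl p.1, Complex.ofReal_re, Real.sqrt_eq_rpow, Complex.ofReal_cpow hpos]
  norm_num

theorem abs_bksKernel_sub_one_le (hs : 0 < s) (hs' : |s' - s| ≤ s / 2) (p : K × E) :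
    |bksKernel X ρ s s' p - 1| ≤ (2 ^ n - 1) * ((s' - s) / s) ^ 2 := by
  obtain ⟨l, hl, hl'⟩ := exists_OmegaRatio_eq_and_OmegaNorm_eq X hAd hinj hρ p
  simpa only [bksKernel, hl, hl', Complex.ofReal_re, Fintype.card_fin] using
    abs_sqrt_prod_sinhQuot_div_sub_one_le hs hs' l

variable [MeasurableSpace E] [BorelSpace E] [MeasurableSpace K]

theorem measurable_OmegaNorm (s : ℝ) : Measurable fun p : K × E => OmegaNorm X ρ s p :=
  (Complex.measurable_re.comp (measurable_OmegaRatio X hAd hinj hρ s s)).sqrt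

theorem measurable_bksKernel (s s' : ℝ) : Measurable fun p : K × E => bksKernel X ρ s s' p :=
  (Complex.measurable_re.comp (measurable_OmegaRatio X hAd hinj hρ s s')).sqrt.div
    ((measurable_OmegaNorm X hAd hinj hρ s).sqrt.mul (measurable_OmegaNorm X hAd hinj hρ s').sqrt)

variable {X} {μ : Measure K}

theorem memLp_fiberMeasure_iff (hs : 0 < s) {f : K × E → ℂ} :
    MemLp f 2 (fiberMeasure X ρ μ s) ↔
      MemLp (fun p => f p * ((√(OmegaNorm X ρ s p) : ℝ) : ℂ)) 2 (liouvilleMeasure X μ) := by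
  rw [fiberMeasure]
  simpa only [Complex.real_smul, mul_comm] using memLp_two_withDensity_iff (f := f)
    (measurable_OmegaNorm X hAd hinj hρ s) (OmegaNorm_pos X hAd hinj hρ hs)

theorem coeFn_untrivialize (hs : 0 < s) (σ : PrequantumFiber X ρ μ s) :
    untrivialize s σ =ᵐ[liouvilleMeasure X μ] fun p => σ p * ((√(OmegaNorm X ρ s p) : ℝ) : ℂ) := by
  have h := (memLp_fiberMeasure_iff hAd hinj hρ hs).1 (Lp.memLp σ)
  rw [untrivialize, dif_pos h]
  exact h.coeFn_toLp

theorem coeFn_trivialize (hs : 0 < s) (g : Lp ℂ 2 (liouvilleMeasure X μ)) :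
    (trivialize s g : PrequantumFiber X ρ μ s) =ᵐ[liouvilleMeasure X μ]
      fun p => g p / ((√(OmegaNorm X ρ s p) : ℝ) : ℂ) := by
  have h : MemLp (fun p => g p / ((√(OmegaNorm X ρ s p) : ℝ) : ℂ)) 2 (fiberMeasure X ρ μ s) := by
    refine (memLp_fiberMeasure_iff hAd hinj hρ hs).2 ?_
    simpa only [div_mul_cancel₀ _ (ofReal_sqrt_OmegaNorm_ne_zero X hAd hinj hρ hs _)]
      using Lp.memLp g
  rw [trivialize, dif_pos h]
  exact (ae_withDensity_ofReal (measurable_OmegaNorm X hAd hinj hρ s)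
    (OmegaNorm_pos X hAd hinj hρ hs)).ge h.coeFn_toLp

theorem untrivialize_trivialize (hs : 0 < s) (g : Lp ℂ 2 (liouvilleMeasure X μ)) :
    untrivialize s (trivialize s g : PrequantumFiber X ρ μ s) = g := by
  refine Lp.ext ?_
  filter_upwards [coeFn_untrivialize hAd hinj hρ hs (trivialize s g),
    coeFn_trivialize hAd hinj hρ hs g] with p hp hp'
  rw [hp, hp', div_mul_cancel₀ _ (ofReal_sqrt_OmegaNorm_ne_zero X hAd hinj hρ hs p)]

theorem inner_eq_inner_untrivialize (hs : 0 < s) (τ σ : PrequantumFiber X ρ μ s) :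
    inner ℂ τ σ = inner ℂ (untrivialize s τ) (untrivialize s σ) := by
  rw [L2.inner_def, L2.inner_def]
  refine (integral_withDensity_eq_integral_toReal_smul
    (measurable_OmegaNorm X hAd hinj hρ s).ennreal_ofReal
    (Filter.Eventually.of_forall fun p => ENNReal.ofReal_lt_top) _).trans (integral_congr_ae ?_)
  filter_upwards [coeFn_untrivialize hAd hinj hρ hs τ, coeFn_untrivialize hAd hinj hρ hs σ]
    with p hτ hσ
  have hpos := (OmegaNorm_pos X hAd hinj hρ hs p).le
  have hsq : (OmegaNorm X ρ s p : ℂ) =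
      ((√(OmegaNorm X ρ s p) : ℝ) : ℂ) * ((√(OmegaNorm X ρ s p) : ℝ) : ℂ) := by
    rw [← Complex.ofReal_mul, Real.mul_self_sqrt hpos]
  rw [hτ, hσ, RCLike.inner_apply, RCLike.inner_apply, map_mul, Complex.conj_ofReal,
    ENNReal.toReal_ofReal hpos, Complex.real_smul, hsq]
  ring

theorem bksPairing_eq_integral_bksKernel (hs : 0 < s) (hs' : 0 < s')
    (τ : PrequantumFiber X ρ μ s) (σ' : PrequantumFiber X ρ μ s') :
    bksPairing τ σ' = ∫ p, starRingEnd ℂ (untrivialize s τ p) * untrivialize s' σ' p *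
      (bksKernel X ρ s s' p : ℂ) ∂(liouvilleMeasure X μ) := by
  refine integral_congr_ae ?_
  filter_upwards [coeFn_untrivialize hAd hinj hρ hs τ, coeFn_untrivialize hAd hinj hρ hs' σ']
    with p hτ hσ'
  have hne := ofReal_sqrt_OmegaNorm_ne_zero X hAd hinj hρ hs p
  have hne' := ofReal_sqrt_OmegaNorm_ne_zero X hAd hinj hρ hs' p
  rw [hτ, hσ', OmegaRatio_cpow_half X hAd hinj hρ hs hs', bksKernel, map_mul, Complex.conj_ofReal,
    Complex.ofReal_div, Complex.ofReal_mul]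
  field_simp

theorem norm_bksPairing_sub_inner_le (hs : 0 < s) (hs' : |s' - s| ≤ s / 2)
    (τ : PrequantumFiber X ρ μ s) (σ' : PrequantumFiber X ρ μ s') :
    ‖bksPairing τ σ' - inner ℂ (untrivialize s τ) (untrivialize s' σ')‖ ≤
      (2 ^ n - 1) * ((s' - s) / s) ^ 2 * (‖untrivialize s τ‖ * ‖untrivialize s' σ'‖) := by
  rw [bksPairing_eq_integral_bksKernel hAd hinj hρ hs (by linarith [(abs_le.1 hs').1]) τ σ']
  refine norm_integral_mul_kernel_sub_inner_le _ _ (κ := fun p => (bksKernel X ρ s s' p : ℂ))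
    (Complex.measurable_ofReal.comp
      (measurable_bksKernel X hAd hinj hρ s s')).aestronglyMeasurable
    (Filter.Eventually.of_forall fun p => ?_)
  rw [← Complex.ofReal_one, ← Complex.ofReal_sub, Complex.norm_real]
  exact abs_bksKernel_sub_one_le X hAd hinj hρ hs hs' p

theorem hasDerivAt_bksPairing_sub_inner (hs : 0 < s) {σ : ∀ s : ℝ, PrequantumFiber X ρ μ s}
    (hσ : SectionDifferentiableAt σ s) (τ : PrequantumFiber X ρ μ s) :
    HasDerivAt (fun r => bksPairing τ (σ r) - inner ℂ (untrivialize s τ) (untrivialize r (σ r)))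
      0 s := by
  have hbounded : (fun r => untrivialize r (σ r)) =O[nhds s] fun _ => (1 : ℝ) :=
    hσ.continuousAt.isBigO_one ℝ
  have hquadratic : (fun r => bksPairing τ (σ r) -
      inner ℂ (untrivialize s τ) (untrivialize r (σ r))) =O[nhds s]
        fun r => ‖r - s‖ ^ 2 * ‖untrivialize r (σ r)‖ := by
    refine Asymptotics.IsBigO.of_bound ((2 ^ n - 1) / s ^ 2 * ‖untrivialize s τ‖) ?_
    filter_upwards [Metric.closedBall_mem_nhds s (half_pos hs)] with r hr
    refine (norm_bksPairing_sub_inner_le hAd hinj hρ hs hr τ (σ r)).trans_eq ?_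
    rw [norm_mul, norm_pow, norm_norm, norm_norm, Real.norm_eq_abs, sq_abs, div_pow]
    ring
  refine (hasFDerivAt_iff_hasDerivAt.1 (Asymptotics.IsBigO.hasFDerivAt (𝕜 := ℝ) (n := 2) ?_
    one_lt_two)).congr_deriv (by simp)
  simpa only [mul_one] using
    hquadratic.trans ((Asymptotics.isBigO_refl _ _).mul hbounded.norm_left)

theorem hasDerivAt_bksPairing (hs : 0 < s) {σ : ∀ s : ℝ, PrequantumFiber X ρ μ s}
    (hσ : SectionDifferentiableAt σ s) (τ : PrequantumFiber X ρ μ s) :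
    HasDerivAt (fun s' : ℝ => bksPairing τ (σ s')) (inner ℂ τ (prequantumConnection σ s)) s := by
  have hinner := (hasDerivAt_const s (untrivialize s τ)).inner ℂ hσ.hasDerivAt
  refine ((hasDerivAt_bksPairing_sub_inner hAd hinj hρ hs hσ τ).add hinner).congr_deriv ?_
    |>.congr_of_eventuallyEq (Filter.Eventually.of_forall fun r => (sub_add_cancel _ _).symm)
  rw [zero_add, inner_zero_left, add_zero, inner_eq_inner_untrivialize hAd hinj hρ hs,
    prequantumConnection, untrivialize_trivialize hAd hinj hρ hs]

end Connections

theorem theorem3p1_general {n N : ℕ}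
    {E : Type*} [NormedAddCommGroup E] [InnerProductSpace ℝ E] [FiniteDimensional ℝ E]
    [MeasurableSpace E] [BorelSpace E]
    {K : Type*} [Group K] [TopologicalSpace K] [ChartedSpace E K] [LieGroup 𝓘(ℝ, E) ∞ K]
    [MeasurableSpace K]
    (X : OrthonormalBasis (Fin n) ℝ E) (hAd : IsAdInvariant (E := E) K)
    (ρ : K →* unitary (Mat N)) (hinj : Function.Injective (repDeriv (E := E) ρ))
    (hρ : ContMDiff 𝓘(ℝ, E) 𝓘(ℝ, Mat N) ∞ fun x : K => (ρ x : Mat N))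
    (μ : Measure K) (σ : ∀ s : ℝ, PrequantumFiber X ρ μ s)
    (s : ℝ) (hs : 0 < s) (hσs : SectionDifferentiableAt σ s)
    (H : Submodule ℂ (PrequantumFiber X ρ μ s)) [H.HasOrthogonalProjection]
    (D : PrequantumFiber X ρ μ s) :
    (D ∈ H ∧ ∀ τ ∈ H, HasDerivAt (fun s' : ℝ => bksPairing τ (σ s')) (inner ℂ τ D) s) ↔
      D = H.starProjection (prequantumConnection σ s) := by
  have hderiv := fun τ => hasDerivAt_bksPairing hAd hinj hρ hs hσs τ
  rw [eq_starProjection_iff_mem_and_inner_eq]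
  exact and_congr_right fun _ => forall₂_congr fun τ _ =>
    ⟨fun h => h.unique (hderiv τ), fun h => h ▸ hderiv τ⟩

theorem theorem3p1 {n N : ℕ}
    {E : Type*} [NormedAddCommGroup E] [InnerProductSpace ℝ E] [FiniteDimensional ℝ E]
    [MeasurableSpace E] [BorelSpace E]
    {K : Type*} [Group K] [TopologicalSpace K] [ChartedSpace E K] [LieGroup 𝓘(ℝ, E) ∞ K]
    [T2Space K] [CompactSpace K] [ConnectedSpace K] [MeasurableSpace K] [BorelSpace K]
    (X : OrthonormalBasis (Fin n) ℝ E) (hAd : IsAdInvariant (E := E) K)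
    (ρ : K →* unitary (Mat N)) (hρ : Function.Injective ρ)
    (hρ_smooth : ContMDiff 𝓘(ℝ, E) 𝓘(ℝ, Mat N) ∞ fun x : K => (ρ x : Mat N))
    (μ : Measure K) [μ.IsHaarMeasure]
    (ħ : ℝ) (hħ : 0 < ħ)
    (σ : ∀ s : ℝ, PrequantumFiber X ρ μ s)
    (hσ : ∀ s : ℝ, 0 < s → σ s ∈ quantumFiber X ρ μ ħ s)
    (s : ℝ) (hs : 0 < s) (hσs : SectionDifferentiableAt σ s)
    (D : PrequantumFiber X ρ μ s) :
    IsBKSConnectionValue ħ σ s D ↔ D = quantumConnection ħ σ s :=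
  theorem3p1_general X hAd ρ (repDeriv_injective hρ_smooth hρ) hρ_smooth μ σ s hs hσs
    (quantumFiber X ρ μ ħ s) D
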